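/- Let $\Omega=(0,2\pi)\times(0,2\pi)$, $J(u,v)=\partial_x u\,\partial_y v-\partial_y u\,\partial_x v$ and $\psi_0=\sin x\sin y$. Put $\beta_{n,m}=\frac14(n^2+m^2)$ and let $$H^4=\Big\{\psi=\sum_{n,m\ge1}a_{n,m}\sin\tfrac{nx}2\sin\tfrac{my}2\ :\ \|\psi\|_{H^4}^2=\sum_{n,m\ge1}(1+\beta_{n,m}^2)^2|a_{n,m}|^2<\infty\Big\}.$$ Let $E_1,E_2,E_3\subset H^4$ be the subspaces of those series in which only the terms with, respectively, $n,m$ both odd; $n$ odd and $m$ even; $n$ even and $m$ odd occur. For real $\lambda,\nu,\mu$, an eigenfunction of the spectral problem is a real function $0\ne\psi\in H^4$ with $$\lambda\Delta\psi=-\mu\Delta\psi+\nu\Delta^2\psi+J(\psi_0,(2+\Delta)\psi)\quad\text{a.e. in }\Omega. \qquad (1)$$ (i) Let $\nu>0$, $\mu\ge0$ and $\lambda+\mu+\frac12\nu>0$. Then (1) has at most three linearly independent eigenfunctions, and they can be chosen in $E_1\cup E_2\cup E_3$: every eigenfunction is a linear combination of eigenfunctions (for the same $\lambda,\nu,\mu$)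 that belong to $E_1\cup E_2\cup E_3$. (ii) Let $\nu_c>0$, $\mu_c\ge0$, and let $\psi_c\in E_1\cup E_2\cup E_3$ be an eigenfunction of (1) for $(\lambda,\nu,\mu)=(0,\nu_c,\mu_c)$. Then there are $\varepsilon_0>0$, $C<\infty$ and, for every $\varepsilon\in(0,\varepsilon_0)$, a real number $\delta=\delta(\varepsilon)$ and a function $\varphi=\varphi(\varepsilon)\in H^4$ with $\int_\Omega\psi_c\,\varphi\,dx\,dy=0$, $|\delta|\le C$ and $\|\varphi\|_{H^4}\le C$, such that $$\psi=\psi_0+\varepsilon\psi_c+\varepsilon^2\varphi,\qquad \nu=\nu_c(1+\varepsilon\delta),\qquad \mu=\mu_c(1+\varepsilon\delta)$$ is a solution, with $\psi\in H^4$, of the steady problem $$J(\psi,\Delta\psi)+(-\mu\Delta+\nu\Delta^2)(\psi-\sin x\sin y)=0\ \text{ a.e. in }\Omega,\qquad \psi|_{\partial\Omega}=\Delta\psi|_{\partial\Omega}=0 .$$ -/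

import Mathlib

open MeasureTheory Set Filter Topology
open scoped ContDiff

noncomputable section

namespace VortexFlow

/-- The square fluid domain `(0, 2π) × (0, 2π)`. -/
def domain : Set (ℝ × ℝ) := Ioo 0 (2 * Real.pi) ×ˢ Ioo 0 (2 * Real.pi)

/-- The mode `sin (n x / 2) sin (m y / 2)`, for integers `n, m ≥ 1`. -/
def mode (k : ℕ+ × ℕ+) (p : ℝ × ℝ) : ℝ :=
  Real.sin ((k.1 : ℝ) * p.1 / 2) * Real.sin ((k.2 : ℝ) * p.2 / 2)

/-- `β_{n,m} = (n² + m²) / 4`, the eigenvalue of `-Δ` on the mode `(n, m)`. -/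
def beta (k : ℕ+ × ℕ+) : ℝ := ((k.1 : ℝ) ^ 2 + (k.2 : ℝ) ^ 2) / 4

/-- The inner product `(φ, ψ) = π⁻² ∫∫ φ ψ` of `L²`, for which the modes are orthonormal. -/
def l2Inner (φ ψ : ℝ × ℝ → ℝ) : ℝ :=
  1 / Real.pi ^ 2 * ∫ p in domain, φ p * ψ p

/-- The sine coefficients `a_{n,m}` of a function. -/
def sineCoeff (ψ : ℝ × ℝ → ℝ) (k : ℕ+ × ℕ+) : ℝ := l2Inner ψ (mode k)

/-- The space `H⁴` of double sine series with `∑ (1 + β²)² |a|² < ∞`. For such coefficients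
the series converges absolutely at every point, and `ψ` is its sum. -/
def H4 : Set (ℝ × ℝ → ℝ) :=
  {ψ | Summable (fun k => (1 + beta k ^ 2) ^ 2 * |sineCoeff ψ k| ^ 2) ∧
    ∀ p, HasSum (fun k => sineCoeff ψ k * mode k p) (ψ p)}

/-- The norm of `H⁴`. -/
def h4Norm (ψ : ℝ × ℝ → ℝ) : ℝ :=
  Real.sqrt (∑' k, (1 + beta k ^ 2) ^ 2 * |sineCoeff ψ k| ^ 2)

/-- Series over `n` odd, `m` odd. -/
def E₁ : Set (ℝ × ℝ → ℝ) :=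
  {ψ | ψ ∈ H4 ∧ ∀ n m : ℕ+, ¬ (Odd (n : ℕ) ∧ Odd (m : ℕ)) → sineCoeff ψ (n, m) = 0}

/-- Series over `n` odd, `m` even. -/
def E₂ : Set (ℝ × ℝ → ℝ) :=
  {ψ | ψ ∈ H4 ∧ ∀ n m : ℕ+, ¬ (Odd (n : ℕ) ∧ Even (m : ℕ)) → sineCoeff ψ (n, m) = 0}

/-- Series over `n` even, `m` odd. -/
def E₃ : Set (ℝ × ℝ → ℝ) :=
  {ψ | ψ ∈ H4 ∧ ∀ n m : ℕ+, ¬ (Even (n : ℕ) ∧ Odd (m : ℕ)) → sineCoeff ψ (n, m) = 0}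

/-- Smooth test functions with compact support in the open square. -/
def IsTestFunction (φ : ℝ × ℝ → ℝ) : Prop :=
  ContDiff ℝ ∞ φ ∧ HasCompactSupport φ ∧ tsupport φ ⊆ domain

/-- Partial derivative with respect to `x`. -/
def partialX (φ : ℝ × ℝ → ℝ) (p : ℝ × ℝ) : ℝ := fderiv ℝ φ p (1, 0)

/-- Partial derivative with respect to `y`. -/
def partialY (φ : ℝ × ℝ → ℝ) (p : ℝ × ℝ) : ℝ := fderiv ℝ φ p (0, 1)

/-- `g` is the weak derivative `∂u/∂x` on the square. -/
def HasWeakPartialX (u g : ℝ × ℝ → ℝ) : Prop :=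
  LocallyIntegrableOn u domain ∧ LocallyIntegrableOn g domain ∧
    ∀ φ, IsTestFunction φ →
      ∫ p in domain, u p * partialX φ p = - ∫ p in domain, g p * φ p

/-- `g` is the weak derivative `∂u/∂y` on the square. -/
def HasWeakPartialY (u g : ℝ × ℝ → ℝ) : Prop :=
  LocallyIntegrableOn u domain ∧ LocallyIntegrableOn g domain ∧
    ∀ φ, IsTestFunction φ →
      ∫ p in domain, u p * partialY φ p = - ∫ p in domain, g p * φ p

/-- `w` is the weak Laplacian `Δu` on the square. -/
def HasWeakLaplacian (u w : ℝ × ℝ → ℝ) : Prop :=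
  LocallyIntegrableOn u domain ∧ LocallyIntegrableOn w domain ∧
    ∀ φ, IsTestFunction φ →
      ∫ p in domain, u p * (partialX (partialX φ) p + partialY (partialY φ) p) =
        ∫ p in domain, w p * φ p

/-- `j` is the Jacobian `J(u, v) = ∂ₓu ∂ᵧv - ∂ᵧu ∂ₓv`, with weak derivatives. -/
def HasJacobian (u v j : ℝ × ℝ → ℝ) : Prop :=
  ∃ ux uy vx vy : ℝ × ℝ → ℝ,
    HasWeakPartialX u ux ∧ HasWeakPartialY u uy ∧
    HasWeakPartialX v vx ∧ HasWeakPartialY v vy ∧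
    ∀ p, j p = ux p * vy p - uy p * vx p

/-- The basic flow `ψ₀ = sin x sin y`. -/
def psi0 (p : ℝ × ℝ) : ℝ := Real.sin p.1 * Real.sin p.2

/-- `ψ` is an eigenfunction of
`λ Δψ = -μ Δψ + ν Δ²ψ + J(ψ₀, (2 + Δ)ψ)`.
Here `w = Δψ`, `z = Δ²ψ` and `j = J(ψ₀, (2 + Δ)ψ)`. -/
def IsEigenfunction (lam ν μ : ℝ) (ψ : ℝ × ℝ → ℝ) : Prop :=
  ψ ∈ H4 ∧ ψ ≠ 0 ∧
    ∃ w z j : ℝ × ℝ → ℝ,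
      HasWeakLaplacian ψ w ∧ HasWeakLaplacian w z ∧
      HasJacobian psi0 (fun p => 2 * ψ p + w p) j ∧
      ∀ᵐ p ∂(volume.restrict domain), lam * w p = -μ * w p + ν * z p + j p

/-- `ψ` solves the steady problem
`J(ψ, Δψ) + (-μ Δ + ν Δ²)(ψ - ψ₀) = 0` in the square, `ψ = Δψ = 0` on its boundary.
Here `w = Δψ` (continuous up to the boundary), `j = J(ψ, Δψ)`, `d = Δ(ψ - ψ₀)` and
`z = Δ²(ψ - ψ₀)`. -/
def IsSteadySolution (ν μ : ℝ) (ψ : ℝ × ℝ → ℝ) : Prop :=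
  ψ ∈ H4 ∧
    ∃ w j d z : ℝ × ℝ → ℝ,
      HasWeakLaplacian ψ w ∧ ContinuousOn w (closure domain) ∧
      (∀ p ∈ frontier domain, ψ p = 0 ∧ w p = 0) ∧
      HasJacobian ψ w j ∧
      HasWeakLaplacian (fun p => ψ p - psi0 p) d ∧ HasWeakLaplacian d z ∧
      ∀ᵐ p ∂(volume.restrict domain), j p + (-μ * d p + ν * z p) = 0

end VortexFlow

end

/-! Multiplying the sine coefficients by 1 + β² identifies H⁴ isometrically with ℓ² (`flow`). Since
∑ β⁻² < ∞, an H⁴ function, its gradient and its Laplacian are uniformly convergent series. Hence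
J(ψ, Δφ) is made of products of bounded functions with L² functions, and its sine coefficients are a
bounded bilinear map (`jac`) on ℓ². The sine modes are complete in L² and weak derivatives are
unique a.e., so both problems become equations in ℓ². With s = λ + μ, (1) reads Lu = Vu + Au = 0,
where V = -sΔ + νΔ² is diagonal and A = J(ψ₀, (2 + Δ)·) is compact relative to it.

Part (i) rests on an energy identity. J(ψ₀, ·) is skew in L², so pairing Lu = 0 with (2 + Δ)u leaves
∑ β(s + νβ)(2 - β)|a|² = 0. Here s + νβ > 0 because β ≥ 1/2, while 2 - β is positive only at (1,1),
(1,2), (2,1) and zero only at (2,2). If those three coefficients vanish, only the mode (2,2) can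
survive; A kills it, and V is injective, so u = 0 (`linOp_eq_zero`). The kernel therefore has
dimension at most three. The Jacobian of two modes has the sum of their parities mod 2, and ψ₀ is
even-even, so L commutes with the projections onto parity classes; the even-even part of a kernel
element contains none of the three modes and vanishes.

Part (ii) is a Lyapunov–Schmidt argument in the closure of Eᵢ under the nonlinearity: the modes with
parities in a subgroup G of order two. It contains one of the three modes, so the kernel there is
spanned by c, the coefficients of ψ_c. The same energy form shows that Vc is not in the range of L
on the class (`linOp_ne_visc`), which is transversality for the simultaneous rescaling of ν and μ.
Hence u ↦ Lu + (c, u)Vc is injective on the class, and by the Fredholm alternative it can be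
inverted. After division by ε² the steady equation becomes Lφ + δVc + J(ψ_c, Δψ_c) + O(ε) = 0. Both
unknowns are packed into one sequence b, with δ = (c, b) and φ the part of b orthogonal to c, and a
contraction solves for b when ε is small. -/

noncomputable section

namespace VortexFlow
/-! ### Square-summable sequences -/

section Sequences

variable {ι : Type*}

/-- Square-summable real sequences. -/
abbrev SqSeq (ι : Type*) : Type _ := lp (fun _ : ι => ℝ) 2

/-- A bounded family of real numbers. -/
def IsBdd (d : ι → ℝ) : Prop := ∃ C, ∀ k, |d k| ≤ C

theorem SqSeq.summable_sq (u : SqSeq ι) : Summable fun k => u k ^ 2 := by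
  simpa using (lp.memℓp u).summable (by norm_num)

theorem SqSeq.norm_sq_eq (u : SqSeq ι) : ‖u‖ ^ 2 = ∑' k, u k ^ 2 := by
  simpa using lp.norm_rpow_eq_tsum (by norm_num : 0 < (2 : ENNReal).toReal) u

theorem memℓp_two_of_summable {f : ι → ℝ} (h : Summable fun k => f k ^ 2) : Memℓp f 2 :=
  memℓp_gen (by simpa using h)

/-- Build a square-summable sequence. -/
def SqSeq.mk (f : ι → ℝ) (h : Summable fun k => f k ^ 2) : SqSeq ι :=
  ⟨f, memℓp_two_of_summable h⟩

@[simp] theorem SqSeq.mk_apply (f : ι → ℝ) (h : Summable fun k => f k ^ 2) (k : ι) :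
    SqSeq.mk f h k = f k := rfl

theorem mul_sq_le {d C x : ℝ} (h : |d| ≤ C) : (d * x) ^ 2 ≤ C ^ 2 * x ^ 2 := by
  rw [mul_pow]
  exact mul_le_mul_of_nonneg_right (sq_le_sq' (neg_le_of_abs_le h) (le_of_abs_le h)) (sq_nonneg _)

open Classical in
/-- The diagonal operator with bounded entries `d` (zero if `d` is unbounded). -/
def diag (d : ι → ℝ) : SqSeq ι →L[ℝ] SqSeq ι :=
  if h : IsBdd d then
    LinearMap.mkContinuous
      { toFun := fun u => SqSeq.mk (fun k => d k * u k)
          (Summable.of_nonneg_of_le (fun _ => sq_nonneg _) (fun k => mul_sq_le (h.choose_spec k))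
            (u.summable_sq.mul_left _))
        map_add' := fun u v => by ext k; simp [mul_add]
        map_smul' := fun c u => by ext k; simp; ring }
      |h.choose| (fun u => by
        refine abs_le_of_sq_le_sq' ?_ (by positivity) |>.2
        rw [mul_pow, SqSeq.norm_sq_eq, SqSeq.norm_sq_eq, ← tsum_mul_left]
        refine Summable.tsum_le_tsum (fun k => ?_) (SqSeq.summable_sq _) (u.summable_sq.mul_left _)
        simpa using mul_sq_le (x := u k) ((h.choose_spec k).trans (le_abs_self _)))
  else 0

theorem diag_apply {d : ι → ℝ} (h : IsBdd d) (u : SqSeq ι) (k : ι) : diag d u k = d k * u k := by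
  simp [diag, h]

theorem diag_norm_le {d : ι → ℝ} {C : ℝ} (hC : 0 ≤ C) (h : ∀ k, |d k| ≤ C) : ‖diag d‖ ≤ C := by
  refine ContinuousLinearMap.opNorm_le_bound _ hC fun u => ?_
  refine abs_le_of_sq_le_sq' ?_ (by positivity) |>.2
  rw [mul_pow, SqSeq.norm_sq_eq, SqSeq.norm_sq_eq, ← tsum_mul_left]
  refine Summable.tsum_le_tsum (fun k => ?_) (SqSeq.summable_sq _) (u.summable_sq.mul_left _)
  rw [diag_apply ⟨C, h⟩]
  exact mul_sq_le (h k)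

theorem IsBdd.mul {d e : ι → ℝ} (hd : IsBdd d) (he : IsBdd e) : IsBdd fun k => d k * e k := by
  obtain ⟨C, hC⟩ := hd
  obtain ⟨D, hD⟩ := he
  refine ⟨C * D, fun k => ?_⟩
  rw [abs_mul]
  exact mul_le_mul (hC k) (hD k) (abs_nonneg _) ((abs_nonneg _).trans (hC k))

theorem IsBdd.const (c : ℝ) : IsBdd fun _ : ι => c := ⟨|c|, fun _ => le_rfl⟩

theorem diag_diag {d e f : ι → ℝ} (hd : IsBdd d) (he : IsBdd e) (hf : ∀ k, f k = d k * e k)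
    (u : SqSeq ι) : diag d (diag e u) = diag f u := by
  have : f = fun k => d k * e k := funext hf
  subst this
  ext k
  simp [diag_apply hd, diag_apply he, diag_apply (hd.mul he), mul_assoc]

theorem diag_smul {d e : ι → ℝ} (hd : IsBdd d) (c : ℝ) (he : ∀ k, e k = c * d k)
    (u : SqSeq ι) : c • diag d u = diag e u := by
  have : e = fun k => c * d k := funext he
  subst this
  ext k
  simp [diag_apply hd, diag_apply ((IsBdd.const c).mul hd), mul_assoc]

theorem diag_one (u : SqSeq ι) : diag (fun _ => 1) u = u := by
  ext k
  simp [diag_apply (IsBdd.const 1)]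

variable {E : Type*} [NormedAddCommGroup E] [NormedSpace ℝ E]

theorem summable_norm_smul {x : ι → E} (h : Summable fun k => ‖x k‖ ^ 2) (u : SqSeq ι) :
    Summable fun k => ‖u k • x k‖ := by
  refine Summable.of_nonneg_of_le (fun _ => norm_nonneg _) (fun k => ?_)
    (u.summable_sq.add h)
  rw [norm_smul, Real.norm_eq_abs, ← sq_abs (u k)]
  nlinarith [sq_nonneg (|u k| - ‖x k‖), sq_nonneg (|u k| + ‖x k‖)]

theorem tsum_norm_smul_le {x : ι → E} (h : Summable fun k => ‖x k‖ ^ 2) (u : SqSeq ι) :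
    ∑' k, ‖u k • x k‖ ≤ Real.sqrt (∑' k, ‖x k‖ ^ 2) * ‖u‖ := by
  have hx : Summable fun k => (‖x k‖ : ℝ) ^ 2 := h
  let y : SqSeq ι := SqSeq.mk (fun k => ‖x k‖) hx
  let v : SqSeq ι := SqSeq.mk (fun k => |u k|) (by simpa using u.summable_sq)
  have hv : ‖v‖ = ‖u‖ := by
    refine (sq_eq_sq₀ (norm_nonneg _) (norm_nonneg _)).1 ?_
    rw [SqSeq.norm_sq_eq, SqSeq.norm_sq_eq]
    simp [v]
  have hy : ‖y‖ = Real.sqrt (∑' k, ‖x k‖ ^ 2) := by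
    rw [← Real.sqrt_sq (norm_nonneg y), SqSeq.norm_sq_eq]
    simp [y]
  have := real_inner_le_norm y v
  rw [lp.inner_eq_tsum, hv, hy] at this
  simpa [norm_smul, y, v, mul_comm] using this

variable [CompleteSpace E]

open Classical in
/-- The synthesis operator `u ↦ ∑ u k • x k` of a square-summable family of vectors. -/
def synth (x : ι → E) : SqSeq ι →L[ℝ] E :=
  if h : Summable fun k => ‖x k‖ ^ 2 then
    LinearMap.mkContinuous
      { toFun := fun u => ∑' k, u k • x k
        map_add' := fun u v => by
          rw [← (summable_norm_smul h u).of_norm.tsum_add (summable_norm_smul h v).of_norm]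
          simp [add_smul]
        map_smul' := fun c u => by
          rw [RingHom.id_apply, ← (summable_norm_smul h u).of_norm.tsum_const_smul]
          simp [mul_smul] }
      (Real.sqrt (∑' k, ‖x k‖ ^ 2)) (fun u =>
        (norm_tsum_le_tsum_norm (summable_norm_smul h u)).trans (tsum_norm_smul_le h u))
  else 0

theorem synth_hasSum {x : ι → E} (h : Summable fun k => ‖x k‖ ^ 2) (u : SqSeq ι) :
    HasSum (fun k => u k • x k) (synth x u) := by
  simpa [synth, h] using (summable_norm_smul h u).of_norm.hasSum

variable [DecidableEq ι]

theorem synth_single {x : ι → E} (h : Summable fun k => ‖x k‖ ^ 2) (k : ι) :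
    synth x (lp.single 2 k 1) = x k := by
  refine (synth_hasSum h _).unique ?_
  convert hasSum_ite_eq k (x k) using 2 with j
  rw [lp.single_apply, Pi.single_apply]
  split_ifs with hj <;> simp [hj]

theorem diag_single {d : ι → ℝ} (h : IsBdd d) (k : ι) :
    diag d (lp.single 2 k 1) = d k • lp.single 2 k 1 := by
  ext j
  rw [diag_apply h, lp.single_apply, Pi.single_apply]
  by_cases hj : j = k
  · subst hj; simp
  · simp [hj]

/-- Continuous linear maps on square-summable sequences agreeing on unit vectors are equal. -/
theorem clm_ext_single {F : Type*} [AddCommGroup F] [Module ℝ F] [TopologicalSpace F] [T2Space F]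
    {S T : SqSeq ι →L[ℝ] F}
    (h : ∀ k, S (lp.single 2 k 1) = T (lp.single 2 k 1)) : S = T := by
  refine lp.ext_continuousLinearMap ENNReal.ofNat_ne_top fun k => ?_
  ext
  simpa using h k

/-- The finite truncations have finite rank, and they converge in operator norm because the norm of
the tail is at most the supremum of its entries. -/
theorem isCompactOperator_diag {d : ι → ℝ} (h : Tendsto d cofinite (𝓝 0)) :
    IsCompactOperator (diag d) := by
  have hb : IsBdd d := by
    have h1 : ∀ᶠ k in cofinite, |d k| < 1 := by
      have := h.abs
      rw [abs_zero] at this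
      exact this.eventually_lt_const one_pos
    have hfin : {k | ¬ |d k| < 1}.Finite := h1
    obtain ⟨C, hC⟩ := (hfin.image fun k => |d k|).bddAbove
    refine ⟨max C 1, fun k => ?_⟩
    by_cases hk : |d k| < 1
    · exact hk.le.trans (le_max_right _ _)
    · exact (hC (mem_image_of_mem _ hk)).trans (le_max_left _ _)
  let F : Finset ι → SqSeq ι →L[ℝ] SqSeq ι := fun s => ∑ k ∈ s,
    ((d k • lp.evalCLM ℝ (fun _ : ι => ℝ) 2 k).smulRight (lp.single 2 k 1 : SqSeq ι))
  have hF : ∀ s u j, F s u j = if j ∈ s then d j * u j else 0 := by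
    intro s u j
    simp only [F, sum_apply, lp.coeFn_sum, Finset.sum_apply]
    simp only [ContinuousLinearMap.smulRight_apply, lp.coeFn_smul, Pi.smul_apply, lp.single_apply,
      Pi.single_apply, smul_eq_mul, mul_ite, mul_one, mul_zero, Finset.sum_ite_eq]
    rfl
  have hlim : Tendsto F atTop (𝓝 (diag d)) := by
    rw [Metric.tendsto_atTop]
    intro ε hε
    have h1 : ∀ᶠ k in cofinite, |d k| < ε / 2 := by
      have := h.abs
      rw [abs_zero] at this
      exact this.eventually_lt_const (half_pos hε)
    have hfin : {k | ¬ |d k| < ε / 2}.Finite := h1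
    refine ⟨hfin.toFinset, fun s hs => ?_⟩
    rw [dist_eq_norm, norm_sub_rev]
    refine lt_of_le_of_lt ?_ (half_lt_self hε)
    have hd' : ∀ k, |(if k ∈ s then 0 else d k)| ≤ ε / 2 := by
      intro k
      split_ifs with hk
      · simpa using (half_pos hε).le
      · by_contra hlt
        exact hk (hs (by rw [Finite.mem_toFinset]; exact fun h' : |d k| < ε / 2 => hlt h'.le))
    have heq : diag d - F s = diag (fun k => if k ∈ s then 0 else d k) := by
      ext u j
      rw [sub_apply, lp.coeFn_sub, Pi.sub_apply, hF, diag_apply hb,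
        diag_apply ⟨_, hd'⟩]
      split_ifs <;> simp
    rw [heq]
    exact diag_norm_le (half_pos hε).le hd'
  refine isCompactOperator_of_tendsto hlim (Eventually.of_forall fun s => ?_)
  refine Submodule.sum_mem (compactOperator (RingHom.id ℝ) (SqSeq ι) (SqSeq ι)) fun k _ => ?_
  exact ((isCompactOperator_of_locallyCompactSpace_rng
    (ContinuousLinearMap.toSpanSingleton ℝ (lp.single 2 k 1 : SqSeq ι))).comp_clm
    (d k • lp.evalCLM ℝ (fun _ : ι => ℝ) 2 k))

end Sequences

/-! ### Two abstract tools -/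

section Abstract

variable {E : Type*} [NormedAddCommGroup E] [NormedSpace ℝ E] [CompleteSpace E]

/-- An injective compact perturbation of the identity has a bounded right inverse. -/
theorem exists_rightInverse_of_compact {T : E →L[ℝ] E} (hT : IsCompactOperator T)
    (hinj : ∀ x, x + T x = 0 → x = 0) : ∃ R : E →L[ℝ] E, ∀ x, R x + T (R x) = x := by
  -- Fredholm alternative at -1: injectivity of 1 + T excludes the eigenvalue, so -1 lies in the
  -- resolvent set.
  rcases hT.hasEigenvalue_or_mem_resolventSet (μ := -1) (by norm_num) with h | h
  · obtain ⟨x, hx⟩ := h.exists_hasEigenvector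
    refine absurd (hinj x ?_) hx.2
    have := hx.apply_eq_smul
    rw [ContinuousLinearMap.coe_coe] at this
    rw [this]
    simp
  · obtain ⟨U, hU⟩ := spectrum.mem_resolventSet_iff.1 h
    -- The unit `U` is -1 - T, whence the sign.
    refine ⟨-(↑U⁻¹ : E →L[ℝ] E), fun x => ?_⟩
    have h1 : (U : E →L[ℝ] E) ((↑U⁻¹ : E →L[ℝ] E) x) = x := by
      rw [← mul_apply_eq_comp, Units.mul_inv]
      rfl
    rw [hU] at h1
    simp only [map_neg, map_one, sub_apply, neg_apply, one_apply_eq_self] at h1 ⊢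
    rw [sub_eq_add_neg] at h1
    exact h1

/-- Solvability of a quadratic fixed-point equation with a small parameter. -/
theorem exists_fixedPoint_quadratic (b₀ : E) (A : E →L[ℝ] E) (Q R : E →L[ℝ] E →L[ℝ] E) :
    ∃ ε₀ > (0 : ℝ), ∃ C : ℝ, ∀ ε, 0 < ε → ε < ε₀ →
      ∃ b, ‖b‖ ≤ C ∧ b₀ + ε • (A b + Q b b + ε • R b b) = b := by
  set r := ‖b₀‖ + 1 with hr
  have hr0 : 0 < r := by positivity
  -- For ε < 1 this bounds the Lipschitz constant of the bracket on the ball of radius `r`; the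
  -- added 1 keeps it positive.
  set M := ‖A‖ + 2 * (‖Q‖ + ‖R‖) * r + 1 with hM
  have hM0 : 1 ≤ M := by
    have : 0 ≤ ‖A‖ + 2 * (‖Q‖ + ‖R‖) * r := by positivity
    linarith
  -- The bound gives εMr < 1, so that the ball of radius ‖b₀‖ + 1 is mapped into itself, and εM < 1,
  -- so that the map contracts.
  refine ⟨min 1 (1 / (2 * M * r + 2 * M)), by positivity, r, fun ε hε hε' => ?_⟩
  have hε1 : ε < 1 := hε'.trans_le (min_le_left _ _)
  have hε2 : ε * (2 * M * r + 2 * M) < 1 := by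
    have := hε'.trans_le (min_le_right _ _)
    rwa [lt_div_iff₀ (by positivity)] at this
  let s := Metric.closedBall (0 : E) r
  let f : E → E := fun b => b₀ + ε • (A b + Q b b + ε • R b b)
  have hlip : ∀ x ∈ s, ∀ y ∈ s, ‖f x - f y‖ ≤ ε * M * ‖x - y‖ := by
    intro x hx y hy
    rw [mem_closedBall_zero_iff] at hx hy
    have h1 : f x - f y = ε • (A (x - y) + (Q x (x - y) + Q (x - y) y)
        + ε • (R x (x - y) + R (x - y) y)) := by
      simp only [f, map_sub, sub_apply]
      module
    have hb : ∀ B : E →L[ℝ] E →L[ℝ] E, ‖B x (x - y) + B (x - y) y‖ ≤ 2 * ‖B‖ * r * ‖x - y‖ := by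
      intro B
      calc _ ≤ ‖B‖ * ‖x‖ * ‖x - y‖ + ‖B‖ * ‖x - y‖ * ‖y‖ :=
            (norm_add_le _ _).trans (add_le_add (B.le_opNorm₂ _ _) (B.le_opNorm₂ _ _))
        _ ≤ ‖B‖ * r * ‖x - y‖ + ‖B‖ * ‖x - y‖ * r := by gcongr
        _ = _ := by ring
    rw [h1, norm_smul, Real.norm_of_nonneg hε.le, mul_assoc]
    gcongr
    calc _ ≤ ‖A‖ * ‖x - y‖ + 2 * ‖Q‖ * r * ‖x - y‖ + 1 * (2 * ‖R‖ * r * ‖x - y‖) := by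
          refine (norm_add_le _ _).trans (add_le_add ((norm_add_le _ _).trans
            (add_le_add (A.le_opNorm _) (hb Q))) ?_)
          rw [norm_smul, Real.norm_of_nonneg hε.le]
          exact mul_le_mul hε1.le (hb R) (norm_nonneg _) zero_le_one
      _ ≤ M * ‖x - y‖ := by rw [hM]; nlinarith [norm_nonneg (x - y)]
  have h0 : (0 : E) ∈ s := by simp [s, hr0.le]
  have hmaps : MapsTo f s s := by
    intro x hx
    have h2 := hlip x hx 0 h0
    rw [mem_closedBall_zero_iff] at hx ⊢
    have h3 : f 0 = b₀ := by simp [f]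
    have h4 : ‖f x‖ ≤ ‖f x - f 0‖ + ‖b₀‖ := by
      rw [h3]; simpa using norm_add_le (f x - b₀) b₀
    have h5 : ε * M * ‖x - 0‖ ≤ ε * M * r := by
      rw [sub_zero]; gcongr
    have h6 : 0 < ε * M := by positivity
    have h7 : 0 < ε * M * r := by positivity
    nlinarith
  have hK : ε * M < 1 := by
    have h7 : 0 < ε * M * r := by positivity
    have h6 : 0 < ε * M := by positivity
    nlinarith
  have hcontr : ContractingWith (⟨ε * M, by positivity⟩ : NNReal) (hmaps.restrict f s s) := by
    refine ⟨by exact_mod_cast hK, LipschitzWith.of_dist_le_mul fun x y => ?_⟩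
    have := hlip x x.2 y y.2
    rw [← dist_eq_norm, ← dist_eq_norm] at this
    exact this
  obtain ⟨b, hb, hfix, -⟩ := hcontr.exists_fixedPoint' (Metric.isClosed_closedBall.isComplete)
    hmaps h0 (edist_ne_top _ _)
  exact ⟨b, by simpa [s] using hb, hfix⟩

end Abstract

/-! ### The square as a probability-like measure space and the trigonometric families -/

/-- The measure `π⁻² dx dy` on the square. -/
def sqMeasure : Measure (ℝ × ℝ) := ENNReal.ofReal (1 / Real.pi ^ 2) • volume.restrict domain

theorem isOpen_domain : IsOpen domain := isOpen_Ioo.prod isOpen_Ioo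

theorem measurableSet_domain : MeasurableSet domain := isOpen_domain.measurableSet

theorem volume_domain_lt_top : volume domain < ⊤ := by
  rw [domain, Measure.volume_eq_prod, Measure.prod_prod]
  simp [ENNReal.mul_lt_top_iff]

instance : IsFiniteMeasure sqMeasure := by
  have : IsFiniteMeasure (volume.restrict domain) :=
    ⟨by rw [Measure.restrict_apply_univ]; exact volume_domain_lt_top⟩
  constructor
  rw [sqMeasure, Measure.smul_apply, smul_eq_mul]
  exact ENNReal.mul_lt_top ENNReal.ofReal_lt_top (measure_lt_top _ _)

theorem ae_sqMeasure_eq : ae sqMeasure = ae (volume.restrict domain) := by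
  have h : ENNReal.ofReal (1 / Real.pi ^ 2) ≠ 0 := by
    rw [Ne, ENNReal.ofReal_eq_zero, not_le]
    positivity
  exact Measure.ae_ennreal_smul_measure_eq h _

theorem ae_mem_domain : ∀ᵐ p ∂sqMeasure, p ∈ domain := by
  rw [ae_sqMeasure_eq]
  exact ae_restrict_mem measurableSet_domain

theorem integral_sqMeasure (f : ℝ × ℝ → ℝ) :
    ∫ p, f p ∂sqMeasure = 1 / Real.pi ^ 2 * ∫ p in domain, f p := by
  rw [sqMeasure, integral_smul_measure, ENNReal.toReal_ofReal (by positivity), smul_eq_mul]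

theorem l2Inner_eq (φ ψ : ℝ × ℝ → ℝ) : l2Inner φ ψ = ∫ p, φ p * ψ p ∂sqMeasure := by
  rw [integral_sqMeasure, l2Inner]

/-- The normalized integral over `(0, 2π)`. -/
def mean (f : ℝ → ℝ) : ℝ := 1 / Real.pi * ∫ x in (0)..(2 * Real.pi), f x

theorem integral_tensor (f g : ℝ → ℝ) :
    ∫ p, f p.1 * g p.2 ∂sqMeasure = mean f * mean g := by
  have h0 : (0 : ℝ) ≤ 2 * Real.pi := by positivity
  rw [integral_sqMeasure, domain, Measure.volume_eq_prod, setIntegral_prod_mul, mean, mean,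
    intervalIntegral.integral_of_le h0, intervalIntegral.integral_of_le h0,
    integral_Ioc_eq_integral_Ioo, integral_Ioc_eq_integral_Ioo]
  ring

open scoped BoundedContinuousFunction

/-- `sin (n x / 2)`. -/
def sinB (n : ℕ+) : ℝ →ᵇ ℝ :=
  BoundedContinuousFunction.ofNormedAddCommGroup (fun x => Real.sin ((n : ℝ) * x / 2))
    (by fun_prop) 1 (fun _ => Real.abs_sin_le_one _)

/-- `cos (n x / 2)`. -/
def cosB (n : ℕ+) : ℝ →ᵇ ℝ :=
  BoundedContinuousFunction.ofNormedAddCommGroup (fun x => Real.cos ((n : ℝ) * x / 2))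
    (by fun_prop) 1 (fun _ => Real.abs_cos_le_one _)

@[simp] theorem sinB_apply (n : ℕ+) (x : ℝ) : sinB n x = Real.sin ((n : ℝ) * x / 2) := rfl

@[simp] theorem cosB_apply (n : ℕ+) (x : ℝ) : cosB n x = Real.cos ((n : ℝ) * x / 2) := rfl

theorem norm_sinB_le (n : ℕ+) : ‖sinB n‖ ≤ 1 :=
  BoundedContinuousFunction.norm_ofNormedAddCommGroup_le _ zero_le_one _

theorem norm_cosB_le (n : ℕ+) : ‖cosB n‖ ≤ 1 :=
  BoundedContinuousFunction.norm_ofNormedAddCommGroup_le _ zero_le_one _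

/-- The tensor product `f(x) g(y)` of bounded continuous functions. -/
def tensorB (f g : ℝ →ᵇ ℝ) : ℝ × ℝ →ᵇ ℝ :=
  BoundedContinuousFunction.ofNormedAddCommGroup (fun p => f p.1 * g p.2)
    (by fun_prop) (‖f‖ * ‖g‖) (fun p => by
      rw [norm_mul]
      exact mul_le_mul (f.norm_coe_le_norm _) (g.norm_coe_le_norm _) (norm_nonneg _)
        (norm_nonneg _))

@[simp] theorem tensorB_apply (f g : ℝ →ᵇ ℝ) (p : ℝ × ℝ) : tensorB f g p = f p.1 * g p.2 := rfl

theorem norm_tensorB_le {f g : ℝ →ᵇ ℝ} (hf : ‖f‖ ≤ 1) (hg : ‖g‖ ≤ 1) : ‖tensorB f g‖ ≤ 1 :=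
  (BoundedContinuousFunction.norm_ofNormedAddCommGroup_le _ (by positivity) _).trans
    (mul_le_one₀ hf (norm_nonneg _) hg)

/-- The `L²` space of the square. -/
abbrev SqL2 : Type _ := Lp ℝ 2 sqMeasure

/-- The class in `L²` of a bounded continuous function. -/
def toL2 : (ℝ × ℝ →ᵇ ℝ) →L[ℝ] SqL2 := BoundedContinuousFunction.toLp 2 sqMeasure ℝ

theorem coeFn_toL2 (f : ℝ × ℝ →ᵇ ℝ) : toL2 f =ᵐ[sqMeasure] f :=
  BoundedContinuousFunction.coeFn_toLp 2 sqMeasure ℝ f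

theorem inner_toL2 (f : ℝ × ℝ →ᵇ ℝ) (h : SqL2) :
    inner ℝ (toL2 f) h = ∫ p, f p * h p ∂sqMeasure := by
  rw [L2.inner_def]
  refine integral_congr_ae ?_
  filter_upwards [coeFn_toL2 f] with p hp
  rw [hp]
  simp [mul_comm]

theorem inner_toL2_toL2 (f g : ℝ × ℝ →ᵇ ℝ) :
    inner ℝ (toL2 f) (toL2 g) = ∫ p, f p * g p ∂sqMeasure := by
  rw [inner_toL2]
  refine integral_congr_ae ?_
  filter_upwards [coeFn_toL2 g] with p hp
  rw [hp]

theorem orthonormal_tensor {a b : ℕ+ → ℝ →ᵇ ℝ}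
    (ha : ∀ n m, mean (fun x => a n x * a m x) = if n = m then 1 else 0)
    (hb : ∀ n m, mean (fun x => b n x * b m x) = if n = m then 1 else 0) :
    Orthonormal ℝ (fun k : ℕ+ × ℕ+ => toL2 (tensorB (a k.1) (b k.2))) := by
  rw [orthonormal_iff_ite]
  rintro ⟨n, m⟩ ⟨n', m'⟩
  rw [inner_toL2_toL2]
  have : ∀ p : ℝ × ℝ, tensorB (a n) (b m) p * tensorB (a n') (b m') p
      = (fun x => a n x * a n' x) p.1 * (fun x => b m x * b m' x) p.2 := by
    intro p
    simp only [tensorB_apply]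
    ring
  rw [integral_congr_ae (Eventually.of_forall this),
    integral_tensor (fun x => a n x * a n' x) (fun x => b m x * b m' x), ha, hb]
  by_cases h1 : n = n' <;> by_cases h2 : m = m' <;> simp [h1, h2]

theorem integral_cos_half (j : ℤ) :
    ∫ x in (0)..(2 * Real.pi), Real.cos ((j : ℝ) * x / 2) = if j = 0 then 2 * Real.pi else 0 := by
  split_ifs with h
  · simp [h]
  · have hj : (j : ℝ) / 2 ≠ 0 := by
      have : (j : ℝ) ≠ 0 := by exact_mod_cast h
      positivity
    have h1 : ∀ x : ℝ, Real.cos ((j : ℝ) * x / 2) = Real.cos ((j : ℝ) / 2 * x) := by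
      intro x; ring_nf
    simp only [h1]
    rw [intervalIntegral.integral_comp_mul_left (fun x => Real.cos x) hj, integral_cos]
    have : (j : ℝ) / 2 * (2 * Real.pi) = j * Real.pi := by ring
    rw [this, Real.sin_int_mul_pi]
    simp

theorem pnat_intCast_sub_eq_zero (n m : ℕ+) : ((n : ℤ) - (m : ℤ) = 0) ↔ n = m := by
  rw [sub_eq_zero]
  norm_cast

theorem mean_sin_mul_sin (n m : ℕ+) :
    mean (fun x => sinB n x * sinB m x) = if n = m then 1 else 0 := by
  have h1 : ∀ x : ℝ, sinB n x * sinB m x = (1 / 2) * Real.cos ((((n : ℤ) - (m : ℤ) : ℤ) : ℝ) * x / 2)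
      - (1 / 2) * Real.cos ((((n : ℤ) + (m : ℤ) : ℤ) : ℝ) * x / 2) := by
    intro x
    push_cast
    rw [sub_mul, add_mul, sub_div, add_div, Real.cos_sub, Real.cos_add]
    simp only [sinB_apply]
    ring
  have h2 : (n : ℤ) + (m : ℤ) ≠ 0 := by positivity
  simp only [mean, h1]
  rw [intervalIntegral.integral_sub (Continuous.intervalIntegrable (by fun_prop) _ _)
    (Continuous.intervalIntegrable (by fun_prop) _ _), intervalIntegral.integral_const_mul,
    intervalIntegral.integral_const_mul, integral_cos_half, integral_cos_half, if_neg h2]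
  simp only [pnat_intCast_sub_eq_zero]
  have := Real.pi_ne_zero
  split_ifs <;> field_simp <;> ring

theorem mean_cos_mul_cos (n m : ℕ+) :
    mean (fun x => cosB n x * cosB m x) = if n = m then 1 else 0 := by
  have h1 : ∀ x : ℝ, cosB n x * cosB m x = (1 / 2) * Real.cos ((((n : ℤ) - (m : ℤ) : ℤ) : ℝ) * x / 2)
      + (1 / 2) * Real.cos ((((n : ℤ) + (m : ℤ) : ℤ) : ℝ) * x / 2) := by
    intro x
    push_cast
    rw [sub_mul, add_mul, sub_div, add_div, Real.cos_sub, Real.cos_add]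
    simp only [cosB_apply]
    ring
  have h2 : (n : ℤ) + (m : ℤ) ≠ 0 := by positivity
  simp only [mean, h1]
  rw [intervalIntegral.integral_add (Continuous.intervalIntegrable (by fun_prop) _ _)
    (Continuous.intervalIntegrable (by fun_prop) _ _), intervalIntegral.integral_const_mul,
    intervalIntegral.integral_const_mul, integral_cos_half, integral_cos_half, if_neg h2]
  simp only [pnat_intCast_sub_eq_zero]
  have := Real.pi_ne_zero
  split_ifs <;> field_simp <;> ring

/-- Indices of the modes. -/
abbrev Idx : Type := ℕ+ × ℕ+

/-- The mode `sin (n x / 2) sin (m y / 2)` as a bounded continuous function. -/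
def modeB (k : Idx) : ℝ × ℝ →ᵇ ℝ := tensorB (sinB k.1) (sinB k.2)

/-- `cos (n x / 2) sin (m y / 2)`. -/
def cosSinB (k : Idx) : ℝ × ℝ →ᵇ ℝ := tensorB (cosB k.1) (sinB k.2)

/-- `sin (n x / 2) cos (m y / 2)`. -/
def sinCosB (k : Idx) : ℝ × ℝ →ᵇ ℝ := tensorB (sinB k.1) (cosB k.2)

theorem modeB_apply (k : Idx) (p : ℝ × ℝ) : modeB k p = mode k p := rfl

theorem coe_modeB (k : Idx) : ⇑(modeB k) = mode k := rfl

theorem norm_modeB_le (k : Idx) : ‖modeB k‖ ≤ 1 :=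
  norm_tensorB_le (norm_sinB_le _) (norm_sinB_le _)

theorem norm_cosSinB_le (k : Idx) : ‖cosSinB k‖ ≤ 1 :=
  norm_tensorB_le (norm_cosB_le _) (norm_sinB_le _)

theorem norm_sinCosB_le (k : Idx) : ‖sinCosB k‖ ≤ 1 :=
  norm_tensorB_le (norm_sinB_le _) (norm_cosB_le _)

theorem orthonormal_mode : Orthonormal ℝ (fun k : Idx => toL2 (modeB k)) :=
  orthonormal_tensor mean_sin_mul_sin mean_sin_mul_sin

theorem orthonormal_cosSin : Orthonormal ℝ (fun k : Idx => toL2 (cosSinB k)) :=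
  orthonormal_tensor mean_cos_mul_cos mean_sin_mul_sin

theorem orthonormal_sinCos : Orthonormal ℝ (fun k : Idx => toL2 (sinCosB k)) :=
  orthonormal_tensor mean_sin_mul_sin mean_cos_mul_cos

/-! ### Completeness of the sine modes -/

/-- The interval `[0, 2π]`. -/
abbrev Seg : Type := Icc (0 : ℝ) (2 * Real.pi)

/-- The retraction of the plane onto the closed square. -/
def clampSq : C(ℝ × ℝ, Seg × Seg) where
  toFun p := (projIcc 0 (2 * Real.pi) (by positivity) p.1, projIcc 0 (2 * Real.pi) (by positivity) p.2)
  continuous_toFun := by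
    have : Continuous (projIcc (0 : ℝ) (2 * Real.pi) (by positivity)) := continuous_projIcc
    exact (this.comp continuous_fst).prodMk (this.comp continuous_snd)

theorem clampSq_of_mem {p : ℝ × ℝ} (hp : p ∈ domain) :
    ((clampSq p).1 : ℝ) = p.1 ∧ ((clampSq p).2 : ℝ) = p.2 := by
  have h1 : p.1 ∈ Icc (0 : ℝ) (2 * Real.pi) := Ioo_subset_Icc_self hp.1
  have h2 : p.2 ∈ Icc (0 : ℝ) (2 * Real.pi) := Ioo_subset_Icc_self hp.2
  constructor
  · change ((projIcc 0 (2 * Real.pi) (by positivity) p.1 : Seg) : ℝ) = p.1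
    rw [projIcc_of_mem _ h1]
  · change ((projIcc 0 (2 * Real.pi) (by positivity) p.2 : Seg) : ℝ) = p.2
    rw [projIcc_of_mem _ h2]

/-- A continuous function on the closed square, extended to the plane. -/
def extendSq : C(Seg × Seg, ℝ) → (ℝ × ℝ →ᵇ ℝ) := fun g =>
  (BoundedContinuousFunction.mkOfCompact g).compContinuous clampSq

theorem continuous_extendSq : Continuous extendSq := by
  refine (BoundedContinuousFunction.continuous_compContinuous clampSq).comp ?_
  exact (ContinuousMap.isometryEquivBoundedOfCompact (Seg × Seg) ℝ).continuous

theorem extendSq_apply (g : C(Seg × Seg, ℝ)) (p : ℝ × ℝ) : extendSq g p = g (clampSq p) := rfl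

/-- Continuous functions `g` with `g h` orthogonal to all the modes. -/
def Annihilates (h : SqL2) (g : C(Seg × Seg, ℝ)) : Prop :=
  ∀ k, inner ℝ (toL2 (extendSq g * modeB k)) h = 0

/-- `cos (x / 2)` on the closed square. -/
def cosX : C(Seg × Seg, ℝ) := ⟨fun q => Real.cos (q.1 / 2), by fun_prop⟩

/-- `cos (y / 2)` on the closed square. -/
def cosY : C(Seg × Seg, ℝ) := ⟨fun q => Real.cos (q.2 / 2), by fun_prop⟩

theorem toL2_congr {f g : ℝ × ℝ →ᵇ ℝ} (h : ∀ p ∈ domain, f p = g p) : toL2 f = toL2 g := by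
  refine Lp.ext ?_
  filter_upwards [coeFn_toL2 f, coeFn_toL2 g, ae_mem_domain] with p h1 h2 h3
  rw [h1, h2, h p h3]

theorem cos_half_mul_sin_one (x : ℝ) :
    Real.cos (x / 2) * Real.sin (((1 : ℕ+) : ℝ) * x / 2)
      = 1 / 2 * Real.sin (((2 : ℕ+) : ℝ) * x / 2) := by
  have : ((2 : ℕ+) : ℝ) * x / 2 = 2 * (x / 2) := by
    push_cast; ring
  rw [this, Real.sin_two_mul]
  push_cast
  rw [one_mul]
  ring

theorem cos_half_mul_sin_succ (n : ℕ+) (x : ℝ) :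
    Real.cos (x / 2) * Real.sin (((n + 1 : ℕ+) : ℝ) * x / 2)
      = 1 / 2 * Real.sin (((n + 1 + 1 : ℕ+) : ℝ) * x / 2) + 1 / 2 * Real.sin ((n : ℝ) * x / 2) := by
  have h1 : ((n + 1 + 1 : ℕ+) : ℝ) * x / 2 = ((n + 1 : ℕ+) : ℝ) * x / 2 + x / 2 := by
    push_cast; ring
  have h2 : (n : ℝ) * x / 2 = ((n + 1 : ℕ+) : ℝ) * x / 2 - x / 2 := by
    push_cast; ring
  rw [h1, h2, Real.sin_add, Real.sin_sub]
  ring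

/-- By the product-to-sum formula, cos(x/2) times a mode is a combination of the two modes with
neighbouring first index. -/
theorem Annihilates.cosX_mul {h : SqL2} {g : C(Seg × Seg, ℝ)} (hg : Annihilates h g) :
    Annihilates h (cosX * g) := by
  rintro ⟨n, m⟩
  have key : ∀ p ∈ domain, extendSq (cosX * g) p = Real.cos (p.1 / 2) * extendSq g p := by
    intro p hp
    simp only [extendSq_apply, ContinuousMap.mul_apply, cosX, ContinuousMap.coe_mk,
      (clampSq_of_mem hp).1]
  induction n using PNat.recOn with
  -- The lower neighbour would be sin 0 = 0, which has no index in `ℕ+`.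
  | one =>
    have : toL2 (extendSq (cosX * g) * modeB (1, m))
        = (1 / 2 : ℝ) • toL2 (extendSq g * modeB (2, m)) := by
      rw [← map_smul]
      refine toL2_congr fun p hp => ?_
      simp only [BoundedContinuousFunction.coe_mul, BoundedContinuousFunction.coe_smul,
        Pi.mul_apply, key p hp, modeB_apply, mode, smul_eq_mul]
      linear_combination (extendSq g p * Real.sin ((m : ℝ) * p.2 / 2)) * cos_half_mul_sin_one p.1
    rw [this, real_inner_smul_left, hg, mul_zero]
  | succ n _ =>
    have : toL2 (extendSq (cosX * g) * modeB (n + 1, m))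
        = (1 / 2 : ℝ) • toL2 (extendSq g * modeB (n + 1 + 1, m))
          + (1 / 2 : ℝ) • toL2 (extendSq g * modeB (n, m)) := by
      rw [← map_smul, ← map_smul, ← map_add]
      refine toL2_congr fun p hp => ?_
      simp only [BoundedContinuousFunction.coe_mul, BoundedContinuousFunction.coe_smul,
        BoundedContinuousFunction.coe_add, Pi.add_apply,
        Pi.mul_apply, key p hp, modeB_apply, mode, smul_eq_mul]
      linear_combination (extendSq g p * Real.sin ((m : ℝ) * p.2 / 2)) * cos_half_mul_sin_succ n p.1
    rw [this, inner_add_left, real_inner_smul_left, real_inner_smul_left, hg, hg, mul_zero, add_zero]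

theorem Annihilates.cosY_mul {h : SqL2} {g : C(Seg × Seg, ℝ)} (hg : Annihilates h g) :
    Annihilates h (cosY * g) := by
  rintro ⟨n, m⟩
  have key : ∀ p ∈ domain, extendSq (cosY * g) p = Real.cos (p.2 / 2) * extendSq g p := by
    intro p hp
    simp only [extendSq_apply, ContinuousMap.mul_apply, cosY, ContinuousMap.coe_mk,
      (clampSq_of_mem hp).2]
  induction m using PNat.recOn with
  | one =>
    have : toL2 (extendSq (cosY * g) * modeB (n, 1))
        = (1 / 2 : ℝ) • toL2 (extendSq g * modeB (n, 2)) := by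
      rw [← map_smul]
      refine toL2_congr fun p hp => ?_
      simp only [BoundedContinuousFunction.coe_mul, BoundedContinuousFunction.coe_smul,
        Pi.mul_apply, key p hp, modeB_apply, mode, smul_eq_mul]
      linear_combination (extendSq g p * Real.sin ((n : ℝ) * p.1 / 2)) * cos_half_mul_sin_one p.2
    rw [this, real_inner_smul_left, hg, mul_zero]
  | succ m _ =>
    have : toL2 (extendSq (cosY * g) * modeB (n, m + 1))
        = (1 / 2 : ℝ) • toL2 (extendSq g * modeB (n, m + 1 + 1))
          + (1 / 2 : ℝ) • toL2 (extendSq g * modeB (n, m)) := by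
      rw [← map_smul, ← map_smul, ← map_add]
      refine toL2_congr fun p hp => ?_
      simp only [BoundedContinuousFunction.coe_mul, BoundedContinuousFunction.coe_smul,
        BoundedContinuousFunction.coe_add, Pi.add_apply,
        Pi.mul_apply, key p hp, modeB_apply, mode, smul_eq_mul]
      linear_combination (extendSq g p * Real.sin ((n : ℝ) * p.1 / 2)) * cos_half_mul_sin_succ m p.2
    rw [this, inner_add_left, real_inner_smul_left, real_inner_smul_left, hg, hg, mul_zero, add_zero]

theorem Annihilates.add {h : SqL2} {g g' : C(Seg × Seg, ℝ)} (hg : Annihilates h g)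
    (hg' : Annihilates h g') : Annihilates h (g + g') := by
  intro k
  have : extendSq (g + g') * modeB k = extendSq g * modeB k + extendSq g' * modeB k := by
    ext p
    simp [extendSq_apply, add_mul]
  rw [this, map_add, inner_add_left, hg, hg', add_zero]

theorem Annihilates.smul {h : SqL2} {g : C(Seg × Seg, ℝ)} (hg : Annihilates h g) (r : ℝ) :
    Annihilates h (r • g) := by
  intro k
  have : extendSq (r • g) * modeB k = r • (extendSq g * modeB k) := by
    ext p
    simp [extendSq_apply, mul_assoc]
  rw [this, map_smul, real_inner_smul_left, hg, mul_zero]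

/-- The half angle runs over [0, π], where cosine is injective. -/
theorem separatesPoints_cos :
    (Algebra.adjoin ℝ {cosX, cosY} : Subalgebra ℝ C(Seg × Seg, ℝ)).SeparatesPoints := by
  have hinj : ∀ s t : Seg, Real.cos (s / 2) = Real.cos (t / 2) → s = t := by
    intro s t hst
    have := Real.injOn_cos (x₁ := s / 2) ⟨by linarith [s.2.1], by linarith [s.2.2]⟩
      (x₂ := t / 2) ⟨by linarith [t.2.1], by linarith [t.2.2]⟩ hst
    exact Subtype.ext (by linarith)
  intro p q hpq
  by_cases h : p.1 = q.1
  · have h2 : p.2 ≠ q.2 := fun h2 => hpq (Prod.ext h h2)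
    exact ⟨cosY, ⟨cosY, Algebra.subset_adjoin (by simp), rfl⟩, fun he => h2 (hinj _ _ he)⟩
  · exact ⟨cosX, ⟨cosX, Algebra.subset_adjoin (by simp), rfl⟩, fun he => h (hinj _ _ he)⟩

/-- The annihilating functions form a closed subspace that contains 1 and is stable under
multiplication by cos(x/2) and cos(y/2). By Stone–Weierstrass it is everything. -/
theorem annihilates_all {h : SqL2} (hh : ∀ k, inner ℝ (toL2 (modeB k)) h = 0)
    (g : C(Seg × Seg, ℝ)) : Annihilates h g := by
  have h1 : Annihilates h 1 := by
    intro k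
    have : extendSq 1 * modeB k = modeB k := by
      ext p
      simp [extendSq_apply]
    rw [this, hh k]
  have hadj : ∀ a ∈ Algebra.adjoin ℝ {cosX, cosY}, ∀ g, Annihilates h g → Annihilates h (a * g) := by
    intro a ha
    induction ha using Algebra.adjoin_induction with
    | mem x hx =>
      rcases hx with rfl | rfl
      · exact fun g hg => hg.cosX_mul
      · exact fun g hg => hg.cosY_mul
    | algebraMap r =>
      intro g hg
      rw [← Algebra.smul_def]
      exact hg.smul r
    | add x y _ _ hx hy =>
      intro g hg
      rw [add_mul]
      exact (hx g hg).add (hy g hg)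
    | mul x y _ _ hx hy =>
      intro g hg
      rw [mul_assoc]
      exact hx _ (hy g hg)
  have hclosed : IsClosed {g | Annihilates h g} := by
    have : {g | Annihilates h g} = ⋂ k, {g | inner ℝ (toL2 (extendSq g * modeB k)) h = 0} := by
      ext g; simp [Annihilates]
    rw [this]
    refine isClosed_iInter fun k => isClosed_eq ?_ continuous_const
    exact (toL2.continuous.comp (continuous_extendSq.mul continuous_const)).inner continuous_const
  have htop := ContinuousMap.subalgebra_topologicalClosure_eq_top_of_separatesPoints _
    separatesPoints_cos
  have hmem : g ∈ (Algebra.adjoin ℝ {cosX, cosY}).topologicalClosure := by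
    rw [htop]; trivial
  refine closure_minimal (s := (Algebra.adjoin ℝ {cosX, cosY} : Set C(Seg × Seg, ℝ))) ?_ hclosed hmem
  intro a ha
  have := hadj a ha 1 h1
  rwa [mul_one] at this

theorem mode_one_ne_zero {p : ℝ × ℝ} (hp : p ∈ domain) : mode (1, 1) p ≠ 0 := by
  obtain ⟨⟨h1, h2⟩, h3, h4⟩ := hp
  have : 0 < mode (1, 1) p := by
    refine mul_pos (Real.sin_pos_of_pos_of_lt_pi ?_ ?_) (Real.sin_pos_of_pos_of_lt_pi ?_ ?_) <;>
      (push_cast; linarith)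
  exact this.ne'

/-- Annihilation at the single mode (1,1) says that h sin(x/2) sin(y/2) integrates to zero against
every continuous function, so it vanishes a.e.; the sine factor is positive inside the square. -/
theorem eq_zero_of_inner_mode_eq_zero {h : SqL2} (hh : ∀ k, inner ℝ (toL2 (modeB k)) h = 0) :
    h = 0 := by
  have hint : Integrable (fun p => mode (1, 1) p * h p) sqMeasure := by
    have h2 : Integrable h sqMeasure := (Lp.memLp h).integrable one_le_two
    exact h2.bdd_mul (c := 1) (modeB (1, 1)).continuous.aestronglyMeasurable
      (Eventually.of_forall fun p => ((modeB (1, 1)).norm_coe_le_norm p).trans (norm_modeB_le _))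
  have h0 := ae_eq_zero_of_integral_contDiff_smul_eq_zero hint.locallyIntegrable fun g hg _ => by
    let G : C(Seg × Seg, ℝ) := ⟨fun q => g (q.1, q.2), hg.continuous.comp (by fun_prop)⟩
    have := annihilates_all hh G (1, 1)
    rw [inner_toL2] at this
    rw [← this]
    refine integral_congr_ae ?_
    filter_upwards [ae_mem_domain] with p hp
    simp only [BoundedContinuousFunction.coe_mul, Pi.mul_apply, extendSq_apply, G,
      ContinuousMap.coe_mk, (clampSq_of_mem hp).1, (clampSq_of_mem hp).2, modeB_apply, smul_eq_mul]
    ring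
  refine Lp.ext ?_
  filter_upwards [h0, ae_mem_domain, Lp.coeFn_zero ℝ 2 sqMeasure] with p hp1 hp2 hp3
  rw [hp3]
  exact (mul_eq_zero.1 hp1).resolve_left (mode_one_ne_zero hp2)

/-- The sine modes form a Hilbert basis of `L²` of the square. -/
def sineBasis : HilbertBasis Idx ℝ SqL2 :=
  HilbertBasis.mkOfOrthogonalEqBot orthonormal_mode (by
    rw [Submodule.eq_bot_iff]
    intro h hh
    refine eq_zero_of_inner_mode_eq_zero fun k => ?_
    exact (Submodule.mem_orthogonal _ _).1 hh _ (Submodule.subset_span (mem_range_self k)))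

theorem sineBasis_apply (k : Idx) : sineBasis k = toL2 (modeB k) := by
  simp [sineBasis]

/-! ### Weak derivatives of trigonometric series -/

theorem IsTestFunction.fderiv_apply {φ : ℝ × ℝ → ℝ} (hφ : IsTestFunction φ) (v : ℝ × ℝ) :
    IsTestFunction fun p => fderiv ℝ φ p v := by
  obtain ⟨h1, h2, h3⟩ := hφ
  have hs : tsupport (fun p => fderiv ℝ φ p v) ⊆ tsupport φ := by
    refine closure_minimal (fun p hp => ?_) (isClosed_tsupport φ)
    by_contra hn
    have : fderiv ℝ φ p = 0 := by
      by_contra h0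
      exact hn (support_fderiv_subset ℝ h0)
    exact hp (by simp [this])
  refine ⟨(h1.fderiv_right (m := ∞) (by simp)).clm_apply contDiff_const, ?_, hs.trans h3⟩
  exact h2.of_isClosed_subset (isClosed_tsupport _) hs

theorem IsTestFunction.partialX {φ : ℝ × ℝ → ℝ} (hφ : IsTestFunction φ) :
    IsTestFunction (partialX φ) := hφ.fderiv_apply _

theorem IsTestFunction.partialY {φ : ℝ × ℝ → ℝ} (hφ : IsTestFunction φ) :
    IsTestFunction (partialY φ) := hφ.fderiv_apply _

theorem IsTestFunction.eq_zero {φ : ℝ × ℝ → ℝ} (hφ : IsTestFunction φ) {p : ℝ × ℝ}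
    (hp : p ∉ domain) : φ p = 0 := by
  by_contra h
  exact hp (hφ.2.2 (subset_tsupport φ h))

theorem IsTestFunction.exists_bcf {φ : ℝ × ℝ → ℝ} (hφ : IsTestFunction φ) :
    ∃ g : BoundedContinuousFunction (ℝ × ℝ) ℝ, ⇑g = φ := by
  obtain ⟨C, hC⟩ := hφ.2.1.exists_bound_of_continuous hφ.1.continuous
  exact ⟨BoundedContinuousFunction.ofNormedAddCommGroup φ hφ.1.continuous C hC, rfl⟩

theorem setIntegral_domain_mul {f φ : ℝ × ℝ → ℝ} (hφ : IsTestFunction φ) :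
    ∫ p in domain, f p * φ p = ∫ p, f p * φ p :=
  setIntegral_eq_integral_of_forall_compl_eq_zero fun p hp => by rw [hφ.eq_zero hp, mul_zero]

theorem IsTestFunction.integrable_mul {f φ : ℝ × ℝ → ℝ} (hφ : IsTestFunction φ)
    (hf : Continuous f) : Integrable fun p => f p * φ p :=
  (hf.mul hφ.1.continuous).integrable_of_hasCompactSupport hφ.2.1.mul_left

theorem integral_mul_fderiv_test {f φ : ℝ × ℝ → ℝ} (hf : ContDiff ℝ 1 f) (hφ : IsTestFunction φ)
    (v : ℝ × ℝ) :
    ∫ p in domain, f p * fderiv ℝ φ p v = - ∫ p in domain, fderiv ℝ f p v * φ p := by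
  rw [setIntegral_domain_mul (hφ.fderiv_apply v), setIntegral_domain_mul hφ]
  have hf' : Continuous fun p => fderiv ℝ f p v :=
    (hf.continuous_fderiv one_ne_zero).clm_apply continuous_const
  exact integral_mul_fderiv_eq_neg_fderiv_mul_of_integrable (hφ.integrable_mul hf')
    ((hφ.fderiv_apply v).integrable_mul hf.continuous) (hφ.integrable_mul hf.continuous)
    (fun p _ => hf.differentiable one_ne_zero p)
    (fun p _ => hφ.1.differentiable (by simp) p)

theorem fderiv_tensor {f g : ℝ → ℝ} {f' g' : ℝ} {p : ℝ × ℝ} (hf : HasDerivAt f f' p.1)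
    (hg : HasDerivAt g g' p.2) (v : ℝ × ℝ) :
    fderiv ℝ (fun q : ℝ × ℝ => f q.1 * g q.2) p v = f' * v.1 * g p.2 + f p.1 * (g' * v.2) := by
  have h1 := hf.comp_hasFDerivAt p (hasFDerivAt_fst (𝕜 := ℝ) (E := ℝ) (F := ℝ) (p := p))
  have h2 := hg.comp_hasFDerivAt p (hasFDerivAt_snd (𝕜 := ℝ) (E := ℝ) (F := ℝ) (p := p))
  have h3 := (h1.mul h2).fderiv
  change fderiv ℝ ((f ∘ Prod.fst) * (g ∘ Prod.snd)) p v = _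
  rw [h3]
  simp
  ring

theorem hasDerivAt_sinB (n : ℕ+) (x : ℝ) : HasDerivAt (sinB n) ((n : ℝ) / 2 * cosB n x) x := by
  have h := (((hasDerivAt_id x).const_mul (n : ℝ)).div_const 2).sin
  simp only [id, mul_one] at h
  rw [mul_comm]
  exact h

theorem hasDerivAt_cosB (n : ℕ+) (x : ℝ) : HasDerivAt (cosB n) (-((n : ℝ) / 2 * sinB n x)) x := by
  have h := (((hasDerivAt_id x).const_mul (n : ℝ)).div_const 2).cos
  simp only [id, mul_one] at h
  rw [mul_comm, ← neg_mul]
  exact h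

theorem partialX_modeB (k : Idx) (p : ℝ × ℝ) :
    partialX (modeB k) p = (k.1 : ℝ) / 2 * cosSinB k p := by
  have := fderiv_tensor (hasDerivAt_sinB k.1 p.1) (hasDerivAt_sinB k.2 p.2) (1, 0)
  simp only [mul_one, mul_zero, add_zero] at this
  exact this.trans (mul_assoc _ _ _)

theorem partialY_modeB (k : Idx) (p : ℝ × ℝ) :
    partialY (modeB k) p = (k.2 : ℝ) / 2 * sinCosB k p := by
  have := fderiv_tensor (hasDerivAt_sinB k.1 p.1) (hasDerivAt_sinB k.2 p.2) (0, 1)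
  simp only [mul_one, mul_zero, zero_mul, zero_add] at this
  exact this.trans (mul_left_comm _ _ _)

theorem partialX_cosSinB (k : Idx) (p : ℝ × ℝ) :
    partialX (cosSinB k) p = -((k.1 : ℝ) / 2 * modeB k p) := by
  have := fderiv_tensor (hasDerivAt_cosB k.1 p.1) (hasDerivAt_sinB k.2 p.2) (1, 0)
  simp only [mul_one, mul_zero, add_zero] at this
  exact this.trans (by simp only [modeB, tensorB_apply]; ring)

theorem partialY_sinCosB (k : Idx) (p : ℝ × ℝ) :
    partialY (sinCosB k) p = -((k.2 : ℝ) / 2 * modeB k p) := by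
  have := fderiv_tensor (hasDerivAt_sinB k.1 p.1) (hasDerivAt_cosB k.2 p.2) (0, 1)
  simp only [mul_one, mul_zero, zero_mul, zero_add] at this
  exact this.trans (by simp only [modeB, tensorB_apply]; ring)

theorem contDiff_sinB (n : ℕ+) : ContDiff ℝ 1 (sinB n) := by
  change ContDiff ℝ 1 fun x => Real.sin ((n : ℝ) * x / 2)
  fun_prop

theorem contDiff_cosB (n : ℕ+) : ContDiff ℝ 1 (cosB n) := by
  change ContDiff ℝ 1 fun x => Real.cos ((n : ℝ) * x / 2)
  fun_prop

theorem contDiff_tensorB {f g : BoundedContinuousFunction ℝ ℝ} (hf : ContDiff ℝ 1 f)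
    (hg : ContDiff ℝ 1 g) : ContDiff ℝ 1 (tensorB f g) :=
  (hf.comp contDiff_fst).mul (hg.comp contDiff_snd)

theorem integral_modeB_partialX (k : Idx) {φ : ℝ × ℝ → ℝ} (hφ : IsTestFunction φ) :
    ∫ p in domain, modeB k p * partialX φ p
      = -((k.1 : ℝ) / 2 * ∫ p in domain, cosSinB k p * φ p) := by
  have := integral_mul_fderiv_test (f := modeB k)
    (contDiff_tensorB (contDiff_sinB _) (contDiff_sinB _)) hφ (1, 0)
  refine this.trans ?_
  rw [← integral_const_mul]
  congr 1
  refine integral_congr_ae (Eventually.of_forall fun p => ?_)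
  simp only [← mul_assoc]
  rw [← partialX_modeB]
  rfl

theorem integral_modeB_partialY (k : Idx) {φ : ℝ × ℝ → ℝ} (hφ : IsTestFunction φ) :
    ∫ p in domain, modeB k p * partialY φ p
      = -((k.2 : ℝ) / 2 * ∫ p in domain, sinCosB k p * φ p) := by
  have := integral_mul_fderiv_test (f := modeB k)
    (contDiff_tensorB (contDiff_sinB _) (contDiff_sinB _)) hφ (0, 1)
  refine this.trans ?_
  rw [← integral_const_mul]
  congr 1
  refine integral_congr_ae (Eventually.of_forall fun p => ?_)
  simp only [← mul_assoc]
  rw [← partialY_modeB]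
  rfl

theorem integral_cosSinB_partialX (k : Idx) {φ : ℝ × ℝ → ℝ} (hφ : IsTestFunction φ) :
    ∫ p in domain, cosSinB k p * partialX φ p
      = (k.1 : ℝ) / 2 * ∫ p in domain, modeB k p * φ p := by
  have := integral_mul_fderiv_test (f := cosSinB k)
    (contDiff_tensorB (contDiff_cosB _) (contDiff_sinB _)) hφ (1, 0)
  refine this.trans ?_
  rw [← integral_const_mul, ← integral_neg]
  refine integral_congr_ae (Eventually.of_forall fun p => ?_)
  have := partialX_cosSinB k p
  rw [partialX] at this
  simp only [this]
  ring

theorem integral_sinCosB_partialY (k : Idx) {φ : ℝ × ℝ → ℝ} (hφ : IsTestFunction φ) :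
    ∫ p in domain, sinCosB k p * partialY φ p
      = (k.2 : ℝ) / 2 * ∫ p in domain, modeB k p * φ p := by
  have := integral_mul_fderiv_test (f := sinCosB k)
    (contDiff_tensorB (contDiff_sinB _) (contDiff_cosB _)) hφ (0, 1)
  refine this.trans ?_
  rw [← integral_const_mul, ← integral_neg]
  refine integral_congr_ae (Eventually.of_forall fun p => ?_)
  have := partialY_sinCosB k p
  rw [partialY] at this
  simp only [this]
  ring

theorem integral_modeB_laplacian (k : Idx) {φ : ℝ × ℝ → ℝ} (hφ : IsTestFunction φ) :
    ∫ p in domain, modeB k p * (partialX (partialX φ) p + partialY (partialY φ) p)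
      = -(beta k * ∫ p in domain, modeB k p * φ p) := by
  simp only [mul_add]
  rw [integral_add, integral_modeB_partialX k hφ.partialX, integral_modeB_partialY k hφ.partialY,
    integral_cosSinB_partialX k hφ, integral_sinCosB_partialY k hφ, beta]
  · ring
  · exact (hφ.partialX.partialX.integrable_mul (modeB k).continuous).restrict
  · exact (hφ.partialY.partialY.integrable_mul (modeB k).continuous).restrict

/-- The sum of a sine series in `L²`. -/
def sinSeries : SqSeq Idx →L[ℝ] SqL2 := sineBasis.repr.symm.toContinuousLinearEquiv

/-- The sine coefficients of an `L²` function. -/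
def coeffs : SqL2 →L[ℝ] SqSeq Idx := sineBasis.repr.toContinuousLinearEquiv

/-- The sum of a cosine-sine series in `L²`. -/
def cosSinSeries : SqSeq Idx →L[ℝ] SqL2 :=
  orthonormal_cosSin.orthogonalFamily.linearIsometry.toContinuousLinearMap

/-- The sum of a sine-cosine series in `L²`. -/
def sinCosSeries : SqSeq Idx →L[ℝ] SqL2 :=
  orthonormal_sinCos.orthogonalFamily.linearIsometry.toContinuousLinearMap

theorem sinSeries_single (k : Idx) : sinSeries (lp.single 2 k 1) = toL2 (modeB k) := by
  rw [← sineBasis_apply, ← sineBasis.repr_symm_single]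
  rfl

theorem cosSinSeries_single (k : Idx) : cosSinSeries (lp.single 2 k 1) = toL2 (cosSinB k) :=
  (orthonormal_cosSin.orthogonalFamily.linearIsometry_apply_single (1 : ℝ)).trans (one_smul ℝ _)

theorem sinCosSeries_single (k : Idx) : sinCosSeries (lp.single 2 k 1) = toL2 (sinCosB k) :=
  (orthonormal_sinCos.orthogonalFamily.linearIsometry_apply_single (1 : ℝ)).trans (one_smul ℝ _)

@[simp] theorem coeffs_sinSeries (u : SqSeq Idx) : coeffs (sinSeries u) = u :=
  sineBasis.repr.apply_symm_apply u

@[simp] theorem sinSeries_coeffs (f : SqL2) : sinSeries (coeffs f) = f :=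
  sineBasis.repr.symm_apply_apply f

theorem coeffs_apply (f : SqL2) (k : Idx) : coeffs f k = inner ℝ (toL2 (modeB k)) f := by
  rw [← sineBasis_apply]
  exact sineBasis.repr_apply_apply f k

theorem inner_sinSeries (u v : SqSeq Idx) : inner ℝ (sinSeries u) (sinSeries v) = inner ℝ u v :=
  sineBasis.repr.symm.inner_map_map u v

theorem integrableOn_domain (f : SqL2) : IntegrableOn f domain := by
  have h2 : Integrable f sqMeasure := (Lp.memLp f).integrable one_le_two
  have h : ENNReal.ofReal (1 / Real.pi ^ 2) ≠ 0 := by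
    rw [Ne, ENNReal.ofReal_eq_zero, not_le]
    positivity
  exact (integrable_smul_measure h ENNReal.ofReal_ne_top).1 h2

theorem locallyIntegrableOn_domain (f : SqL2) : LocallyIntegrableOn f domain :=
  (integrableOn_domain f).locallyIntegrableOn

theorem setIntegral_eq_inner {φ : ℝ × ℝ → ℝ} {g : BoundedContinuousFunction (ℝ × ℝ) ℝ} (hg : ⇑g = φ)
    (f : SqL2) : ∫ p in domain, f p * φ p = Real.pi ^ 2 * inner ℝ (toL2 g) f := by
  have := Real.pi_ne_zero
  rw [inner_toL2, integral_sqMeasure, hg]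
  simp only [mul_comm]
  field_simp

theorem setIntegral_toL2 (g : BoundedContinuousFunction (ℝ × ℝ) ℝ) (φ : ℝ × ℝ → ℝ) :
    ∫ p in domain, toL2 g p * φ p = ∫ p in domain, g p * φ p := by
  refine integral_congr_ae ?_
  have := coeFn_toL2 g
  rw [EventuallyEq, ae_sqMeasure_eq] at this
  filter_upwards [this] with p hp
  rw [hp]

/-- Testing a series against a function, termwise. -/
theorem setIntegral_series_eq {S T : SqSeq Idx →L[ℝ] SqL2} {σ τ : Idx → BoundedContinuousFunction (ℝ × ℝ) ℝ}
    (hS : ∀ k, S (lp.single 2 k 1) = toL2 (σ k)) (hT : ∀ k, T (lp.single 2 k 1) = toL2 (τ k))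
    {c d : Idx → ℝ} (hc : IsBdd c) (hd : IsBdd d) {φ χ : ℝ × ℝ → ℝ}
    {φB χB : BoundedContinuousFunction (ℝ × ℝ) ℝ} (hφ : ⇑φB = φ) (hχ : ⇑χB = χ)
    (h : ∀ k, c k * ∫ p in domain, σ k p * φ p = d k * ∫ p in domain, τ k p * χ p)
    (u : SqSeq Idx) :
    ∫ p in domain, S (diag c u) p * φ p = ∫ p in domain, T (diag d u) p * χ p := by
  rw [setIntegral_eq_inner hφ, setIntegral_eq_inner hχ]
  congr 1
  -- Both sides are continuous linear functionals of `u`, so it suffices to compare them on unit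
  -- vectors, where the hypothesis is integration by parts for one mode.
  have : (innerSL ℝ (toL2 φB)).comp (S.comp (diag c)) = (innerSL ℝ (toL2 χB)).comp (T.comp (diag d)) := by
    refine clm_ext_single fun k => ?_
    simp only [ContinuousLinearMap.comp_apply, diag_single hc, diag_single hd, map_smul, hS, hT,
      smul_eq_mul, innerSL_apply_apply]
    have hk := h k
    rw [← setIntegral_toL2, ← setIntegral_toL2, setIntegral_eq_inner hφ, setIntegral_eq_inner hχ] at hk
    have hpi : Real.pi ^ 2 ≠ 0 := by positivity
    refine mul_left_cancel₀ hpi ?_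
    linarith
  exact DFunLike.congr_fun this u

/-- Boundedness of both weights makes the series and its formal derivative converge in L², so
termwise differentiation is legitimate in the weak sense. -/
theorem hasWeakPartialX_series {c d : Idx → ℝ} (hc : IsBdd c) (hd : IsBdd d)
    (h : ∀ k, d k = (k.1 : ℝ) / 2 * c k) (u : SqSeq Idx) :
    HasWeakPartialX (sinSeries (diag c u)) (cosSinSeries (diag d u)) := by
  refine ⟨locallyIntegrableOn_domain _, locallyIntegrableOn_domain _, fun φ hφ => ?_⟩
  obtain ⟨φB, hφB⟩ := hφ.exists_bcf
  obtain ⟨χB, hχB⟩ := hφ.partialX.exists_bcf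
  rw [← integral_neg]
  have := setIntegral_series_eq sinSeries_single cosSinSeries_single hc hd hχB
    (χB := -φB) (χ := fun p => - φ p) (by rw [← hφB]; rfl) (fun k => by
      simp only [mul_neg, integral_neg]
      rw [integral_modeB_partialX k hφ, h k]
      ring) u
  simpa using this

theorem hasWeakPartialY_series {c d : Idx → ℝ} (hc : IsBdd c) (hd : IsBdd d)
    (h : ∀ k, d k = (k.2 : ℝ) / 2 * c k) (u : SqSeq Idx) :
    HasWeakPartialY (sinSeries (diag c u)) (sinCosSeries (diag d u)) := by
  refine ⟨locallyIntegrableOn_domain _, locallyIntegrableOn_domain _, fun φ hφ => ?_⟩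
  obtain ⟨φB, hφB⟩ := hφ.exists_bcf
  obtain ⟨χB, hχB⟩ := hφ.partialY.exists_bcf
  rw [← integral_neg]
  have := setIntegral_series_eq sinSeries_single sinCosSeries_single hc hd hχB
    (χB := -φB) (χ := fun p => - φ p) (by rw [← hφB]; rfl) (fun k => by
      simp only [mul_neg, integral_neg]
      rw [integral_modeB_partialY k hφ, h k]
      ring) u
  simpa using this

theorem hasWeakLaplacian_series {c d : Idx → ℝ} (hc : IsBdd c) (hd : IsBdd d)
    (h : ∀ k, d k = -(beta k * c k)) (u : SqSeq Idx) :
    HasWeakLaplacian (sinSeries (diag c u)) (sinSeries (diag d u)) := by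
  refine ⟨locallyIntegrableOn_domain _, locallyIntegrableOn_domain _, fun φ hφ => ?_⟩
  obtain ⟨φB, hφB⟩ := hφ.exists_bcf
  obtain ⟨χB, hχB⟩ := hφ.partialX.partialX.exists_bcf
  obtain ⟨ωB, hωB⟩ := hφ.partialY.partialY.exists_bcf
  refine setIntegral_series_eq sinSeries_single sinSeries_single hc hd
    (φB := χB + ωB) (by rw [← hχB, ← hωB]; rfl) hφB (fun k => ?_) u
  rw [integral_modeB_laplacian k hφ, h k]
  ring

/-! ### Uniqueness of weak derivatives -/

theorem LocallyIntegrableOn.congr_ae_domain {f g : ℝ × ℝ → ℝ}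
    (hf : MeasureTheory.LocallyIntegrableOn f domain) (h : f =ᵐ[volume.restrict domain] g) :
    MeasureTheory.LocallyIntegrableOn g domain := by
  refine (locallyIntegrableOn_iff isOpen_domain.isLocallyClosed).2 fun K hK hKc => ?_
  exact (hf.integrableOn_compact_subset hK hKc).congr_fun_ae (ae_restrict_of_ae_restrict_of_subset hK h)

theorem setIntegral_congr_mul {f g : ℝ × ℝ → ℝ} (h : f =ᵐ[volume.restrict domain] g)
    (φ : ℝ × ℝ → ℝ) : ∫ p in domain, f p * φ p = ∫ p in domain, g p * φ p := by
  refine integral_congr_ae ?_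
  filter_upwards [h] with p hp
  rw [hp]

theorem HasWeakPartialX.congr {u u' g g' : ℝ × ℝ → ℝ} (h : HasWeakPartialX u g)
    (hu : u =ᵐ[volume.restrict domain] u') (hg : g =ᵐ[volume.restrict domain] g') :
    HasWeakPartialX u' g' :=
  ⟨LocallyIntegrableOn.congr_ae_domain h.1 hu, LocallyIntegrableOn.congr_ae_domain h.2.1 hg,
    fun φ hφ => by
      rw [← setIntegral_congr_mul hu, ← setIntegral_congr_mul hg]
      exact h.2.2 φ hφ⟩

theorem HasWeakPartialY.congr {u u' g g' : ℝ × ℝ → ℝ} (h : HasWeakPartialY u g)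
    (hu : u =ᵐ[volume.restrict domain] u') (hg : g =ᵐ[volume.restrict domain] g') :
    HasWeakPartialY u' g' :=
  ⟨LocallyIntegrableOn.congr_ae_domain h.1 hu, LocallyIntegrableOn.congr_ae_domain h.2.1 hg,
    fun φ hφ => by
      rw [← setIntegral_congr_mul hu, ← setIntegral_congr_mul hg]
      exact h.2.2 φ hφ⟩

theorem HasWeakLaplacian.congr {u u' g g' : ℝ × ℝ → ℝ} (h : HasWeakLaplacian u g)
    (hu : u =ᵐ[volume.restrict domain] u') (hg : g =ᵐ[volume.restrict domain] g') :
    HasWeakLaplacian u' g' :=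
  ⟨LocallyIntegrableOn.congr_ae_domain h.1 hu, LocallyIntegrableOn.congr_ae_domain h.2.1 hg,
    fun φ hφ => by
      rw [← setIntegral_congr_mul hu, ← setIntegral_congr_mul hg]
      exact h.2.2 φ hφ⟩

theorem integrable_mul_test {f φ : ℝ × ℝ → ℝ} (hf : MeasureTheory.LocallyIntegrableOn f domain)
    (hφ : IsTestFunction φ) : Integrable fun p => f p * φ p := by
  have hK : IsCompact (tsupport φ) := hφ.2.1
  have h1 : IntegrableOn f (tsupport φ) := hf.integrableOn_compact_subset hφ.2.2 hK
  have h2 := h1.mul_continuousOn hφ.1.continuous.continuousOn hK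
  refine (integrableOn_iff_integrable_of_support_subset ?_).1 h2
  intro p hp
  exact subset_tsupport φ (right_ne_zero_of_mul hp)

/-- The fundamental lemma of the calculus of variations; it makes all weak derivatives below unique
a.e. -/
theorem ae_eq_of_test {f g : ℝ × ℝ → ℝ} (hf : MeasureTheory.LocallyIntegrableOn f domain)
    (hg : MeasureTheory.LocallyIntegrableOn g domain)
    (h : ∀ φ, IsTestFunction φ → ∫ p in domain, f p * φ p = ∫ p in domain, g p * φ p) :
    f =ᵐ[volume.restrict domain] g := by
  have := isOpen_domain.ae_eq_zero_of_integral_contDiff_smul_eq_zero (hf.sub hg)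
    fun φ h1 h2 h3 => by
      have hφ : IsTestFunction φ := ⟨h1, h2, h3⟩
      have h4 := h φ hφ
      rw [setIntegral_domain_mul hφ, setIntegral_domain_mul hφ] at h4
      have h5 : ∀ p, φ p • (f - g) p = f p * φ p - g p * φ p := by
        intro p
        simp only [Pi.sub_apply, smul_eq_mul]
        ring
      simp only [h5]
      rw [integral_sub (integrable_mul_test hf hφ) (integrable_mul_test hg hφ), h4, sub_self]
  refine (ae_restrict_iff' measurableSet_domain).2 ?_
  filter_upwards [this] with p hp hpd
  exact sub_eq_zero.1 (hp hpd)

theorem HasWeakPartialX.unique {u u' g g' : ℝ × ℝ → ℝ} (h : HasWeakPartialX u g)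
    (h' : HasWeakPartialX u' g') (hu : u =ᵐ[volume.restrict domain] u') :
    g =ᵐ[volume.restrict domain] g' :=
  ae_eq_of_test h.2.1 h'.2.1 fun φ hφ => by
    have h1 := h.2.2 φ hφ
    have h2 := h'.2.2 φ hφ
    rw [setIntegral_congr_mul hu, h2] at h1
    linarith

theorem HasWeakPartialY.unique {u u' g g' : ℝ × ℝ → ℝ} (h : HasWeakPartialY u g)
    (h' : HasWeakPartialY u' g') (hu : u =ᵐ[volume.restrict domain] u') :
    g =ᵐ[volume.restrict domain] g' :=
  ae_eq_of_test h.2.1 h'.2.1 fun φ hφ => by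
    have h1 := h.2.2 φ hφ
    have h2 := h'.2.2 φ hφ
    rw [setIntegral_congr_mul hu, h2] at h1
    linarith

theorem HasWeakLaplacian.unique {u u' g g' : ℝ × ℝ → ℝ} (h : HasWeakLaplacian u g)
    (h' : HasWeakLaplacian u' g') (hu : u =ᵐ[volume.restrict domain] u') :
    g =ᵐ[volume.restrict domain] g' :=
  ae_eq_of_test h.2.1 h'.2.1 fun φ hφ => by
    rw [← h.2.2 φ hφ, ← h'.2.2 φ hφ, setIntegral_congr_mul hu]

/-! ### Weights -/

theorem pnat_one_le (n : ℕ+) : (1 : ℝ) ≤ (n : ℝ) := by exact_mod_cast one_le (a := n)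

theorem half_le_beta (k : Idx) : 1 / 2 ≤ beta k := by
  rw [beta]
  nlinarith [pnat_one_le k.1, pnat_one_le k.2]

theorem beta_pos (k : Idx) : 0 < beta k := by linarith [half_le_beta k]

theorem half_fst_le (k : Idx) : (k.1 : ℝ) / 2 ≤ (1 + beta k) / 2 := by
  rw [beta]
  nlinarith [sq_nonneg ((k.1 : ℝ) / 2 - 1), sq_nonneg (k.2 : ℝ)]

theorem half_snd_le (k : Idx) : (k.2 : ℝ) / 2 ≤ (1 + beta k) / 2 := by
  rw [beta]
  nlinarith [sq_nonneg ((k.2 : ℝ) / 2 - 1), sq_nonneg (k.1 : ℝ)]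

theorem one_add_beta_sq_pos (k : Idx) : 0 < 1 + beta k ^ 2 := by positivity

theorem one_add_beta_pos (k : Idx) : 0 < 1 + beta k := by linarith [beta_pos k]

/-- Since 1, β and β² are all at most 1 + β². Most of the weights used below have this shape. -/
theorem isBdd_quad {d : Idx → ℝ} (a b c : ℝ)
    (h : ∀ k, d k = (a + b * beta k + c * beta k ^ 2) / (1 + beta k ^ 2)) : IsBdd d := by
  refine ⟨|a| + |b| + |c|, fun k => ?_⟩
  have h0 := one_add_beta_sq_pos k
  have hb := beta_pos k
  rw [h, abs_div, abs_of_pos h0, div_le_iff₀ h0]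
  have h1 : |a + b * beta k + c * beta k ^ 2| ≤ |a| + |b| * beta k + |c| * beta k ^ 2 := by
    refine (abs_add_three _ _ _).trans ?_
    rw [abs_mul, abs_mul, abs_of_pos hb, abs_of_nonneg (sq_nonneg (beta k))]
  refine h1.trans ?_
  nlinarith [abs_nonneg a, abs_nonneg b, abs_nonneg c, mul_nonneg (abs_nonneg a) (sq_nonneg (beta k)),
    mul_nonneg (abs_nonneg b) (sq_nonneg (beta k - 1)), mul_nonneg (abs_nonneg b) hb.le,
    mul_nonneg (abs_nonneg b) (sq_nonneg (beta k))]

theorem isBdd_inv_one_add : IsBdd fun k : Idx => 1 / (1 + beta k) :=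
  ⟨1, fun k => by
    rw [abs_of_pos (one_div_pos.2 (one_add_beta_pos k)), div_le_one (one_add_beta_pos k)]
    linarith [beta_pos k]⟩

theorem isBdd_fst : IsBdd fun k : Idx => (k.1 : ℝ) / 2 / (1 + beta k) :=
  ⟨1, fun k => by
    have := one_add_beta_pos k
    rw [abs_of_nonneg (by positivity), div_le_one this]
    linarith [half_fst_le k]⟩

theorem isBdd_snd : IsBdd fun k : Idx => (k.2 : ℝ) / 2 / (1 + beta k) :=
  ⟨1, fun k => by
    have := one_add_beta_pos k
    rw [abs_of_nonneg (by positivity), div_le_one this]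
    linarith [half_snd_le k]⟩

/-- Weight turning `H²` coefficients into `H⁴` ones. -/
def liftWeight (k : Idx) : ℝ := (1 + beta k) / (1 + beta k ^ 2)

theorem isBdd_liftWeight : IsBdd liftWeight :=
  isBdd_quad 1 1 0 fun k => by rw [liftWeight]; ring

/-- By β ≥ nm/2 the sum is dominated by a product of two convergent series in one index. -/
theorem summable_inv_beta_sq : Summable fun k : Idx => (1 / beta k) ^ 2 := by
  have h1 : Summable fun n : ℕ+ => 1 / (n : ℝ) ^ 2 :=
    (Real.summable_one_div_nat_pow.2 one_lt_two).comp_injective PNat.coe_injective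
  have h2 : Summable fun k : Idx => 1 / (k.1 : ℝ) ^ 2 * (1 / (k.2 : ℝ) ^ 2) :=
    h1.mul_of_nonneg h1 (fun n => by positivity) (fun n => by positivity)
  refine Summable.of_nonneg_of_le (fun k => sq_nonneg _) (fun k => ?_) (h2.mul_left 4)
  have hk1 : 0 < (k.1 : ℝ) := by linarith [pnat_one_le k.1]
  have hk2 : 0 < (k.2 : ℝ) := by linarith [pnat_one_le k.2]
  have h3 : (k.1 : ℝ) * k.2 / 2 ≤ beta k := by
    rw [beta]
    nlinarith [sq_nonneg ((k.1 : ℝ) - k.2)]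
  have hb := beta_pos k
  calc (1 / beta k) ^ 2 ≤ (1 / ((k.1 : ℝ) * k.2 / 2)) ^ 2 := by gcongr
    _ = 4 * (1 / (k.1 : ℝ) ^ 2 * (1 / (k.2 : ℝ) ^ 2)) := by field_simp; norm_num

theorem summable_norm_sq_smul {w : Idx → ℝ} {σ : Idx → BoundedContinuousFunction (ℝ × ℝ) ℝ}
    (hσ : ∀ k, ‖σ k‖ ≤ 1) (hw : ∀ k, |w k| ≤ 1 / beta k) :
    Summable fun k => ‖w k • σ k‖ ^ 2 := by
  refine Summable.of_nonneg_of_le (fun k => sq_nonneg _) (fun k => ?_) summable_inv_beta_sq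
  rw [norm_smul, Real.norm_eq_abs]
  gcongr
  exact (mul_le_of_le_one_right (abs_nonneg _) (hσ k)).trans (hw k)

/-- The first alternative covers the first derivatives, the second the Laplacian. The bound 1/β is
square-summable, which gives uniform convergence of all these series. -/
theorem abs_weight_le {a : ℝ} {k : Idx} (h : |a| ≤ (1 + beta k) / 2 ∨ |a| = beta k) :
    |a / (1 + beta k ^ 2)| ≤ 1 / beta k := by
  have h0 := one_add_beta_sq_pos k
  have hb := beta_pos k
  rw [abs_div, abs_of_pos h0, div_le_div_iff₀ h0 hb]
  rcases h with h | h
  · nlinarith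
  · rw [h]; nlinarith

theorem one_le_weight (k : Idx) : |(1 : ℝ) / (1 + beta k ^ 2)| ≤ 1 / beta k := by
  have h0 := one_add_beta_sq_pos k
  have hb := beta_pos k
  rw [abs_of_pos (by positivity), div_le_div_iff₀ h0 hb]
  nlinarith [sq_nonneg (beta k - 1)]

/-! ### Functions of class `H⁴` -/

/-- The function with `H⁴`-normalized coefficients `u`. -/
def flow : SqSeq Idx →L[ℝ] BoundedContinuousFunction (ℝ × ℝ) ℝ :=
  synth fun k => (1 / (1 + beta k ^ 2)) • modeB k

/-- The `x`-derivative of `flow u`. -/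
def flowX : SqSeq Idx →L[ℝ] BoundedContinuousFunction (ℝ × ℝ) ℝ :=
  synth fun k => ((k.1 : ℝ) / 2 / (1 + beta k ^ 2)) • cosSinB k

/-- The `y`-derivative of `flow u`. -/
def flowY : SqSeq Idx →L[ℝ] BoundedContinuousFunction (ℝ × ℝ) ℝ :=
  synth fun k => ((k.2 : ℝ) / 2 / (1 + beta k ^ 2)) • sinCosB k

/-- The Laplacian of `flow u`. -/
def flowLap : SqSeq Idx →L[ℝ] BoundedContinuousFunction (ℝ × ℝ) ℝ :=
  synth fun k => (-beta k / (1 + beta k ^ 2)) • modeB k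

theorem summable_flow : Summable fun k : Idx => ‖(1 / (1 + beta k ^ 2)) • modeB k‖ ^ 2 :=
  summable_norm_sq_smul norm_modeB_le one_le_weight

theorem summable_flowX :
    Summable fun k : Idx => ‖((k.1 : ℝ) / 2 / (1 + beta k ^ 2)) • cosSinB k‖ ^ 2 :=
  summable_norm_sq_smul norm_cosSinB_le fun k => abs_weight_le (Or.inl (by
    rw [abs_of_nonneg (by positivity)]; exact half_fst_le k))

theorem summable_flowY :
    Summable fun k : Idx => ‖((k.2 : ℝ) / 2 / (1 + beta k ^ 2)) • sinCosB k‖ ^ 2 :=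
  summable_norm_sq_smul norm_sinCosB_le fun k => abs_weight_le (Or.inl (by
    rw [abs_of_nonneg (by positivity)]; exact half_snd_le k))

theorem summable_flowLap : Summable fun k : Idx => ‖(-beta k / (1 + beta k ^ 2)) • modeB k‖ ^ 2 :=
  summable_norm_sq_smul norm_modeB_le fun k => abs_weight_le (Or.inr (by
    rw [abs_neg, abs_of_pos (beta_pos k)]))

/-- The `L²` function with `H²`-normalized coefficients `e`. -/
def field : SqSeq Idx →L[ℝ] SqL2 := sinSeries.comp (diag fun k => 1 / (1 + beta k))

/-- The `x`-derivative of `field e`. -/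
def fieldX : SqSeq Idx →L[ℝ] SqL2 :=
  cosSinSeries.comp (diag fun k => (k.1 : ℝ) / 2 / (1 + beta k))

/-- The `y`-derivative of `field e`. -/
def fieldY : SqSeq Idx →L[ℝ] SqL2 :=
  sinCosSeries.comp (diag fun k => (k.2 : ℝ) / 2 / (1 + beta k))

/-- The uniform sum and the L² sum of the same series agree, being continuous in the coefficients
and equal on unit vectors. -/
theorem toL2_synth {σ : Idx → BoundedContinuousFunction (ℝ × ℝ) ℝ} {S : SqSeq Idx →L[ℝ] SqL2}
    {w : Idx → ℝ} (hw : IsBdd w) (hs : Summable fun k => ‖w k • σ k‖ ^ 2)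
    (hS : ∀ k, S (lp.single 2 k 1) = toL2 (σ k)) (u : SqSeq Idx) :
    toL2 (synth (fun k => w k • σ k) u) = S (diag w u) := by
  have : toL2.comp (synth fun k => w k • σ k) = S.comp (diag w) :=
    clm_ext_single fun k => by
      simp only [ContinuousLinearMap.comp_apply, synth_single hs, diag_single hw, map_smul, hS]
  exact DFunLike.congr_fun this u

theorem isBdd_flow : IsBdd fun k : Idx => 1 / (1 + beta k ^ 2) :=
  isBdd_quad 1 0 0 fun k => by ring

theorem isBdd_flowLap : IsBdd fun k : Idx => -beta k / (1 + beta k ^ 2) :=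
  isBdd_quad 0 (-1) 0 fun k => by ring

theorem fst_weight_eq (k : Idx) : (k.1 : ℝ) / 2 / (1 + beta k ^ 2)
    = (k.1 : ℝ) / 2 / (1 + beta k) * liftWeight k := by
  have := (one_add_beta_pos k).ne'
  rw [liftWeight]
  field_simp

theorem snd_weight_eq (k : Idx) : (k.2 : ℝ) / 2 / (1 + beta k ^ 2)
    = (k.2 : ℝ) / 2 / (1 + beta k) * liftWeight k := by
  have := (one_add_beta_pos k).ne'
  rw [liftWeight]
  field_simp

theorem isBdd_flowX : IsBdd fun k : Idx => (k.1 : ℝ) / 2 / (1 + beta k ^ 2) := by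
  simp only [fst_weight_eq]
  exact isBdd_fst.mul isBdd_liftWeight

theorem isBdd_flowY : IsBdd fun k : Idx => (k.2 : ℝ) / 2 / (1 + beta k ^ 2) := by
  simp only [snd_weight_eq]
  exact isBdd_snd.mul isBdd_liftWeight

theorem toL2_flow (u : SqSeq Idx) :
    toL2 (flow u) = sinSeries (diag (fun k => 1 / (1 + beta k ^ 2)) u) :=
  toL2_synth isBdd_flow summable_flow sinSeries_single u

theorem toL2_flowLap (u : SqSeq Idx) :
    toL2 (flowLap u) = sinSeries (diag (fun k => -beta k / (1 + beta k ^ 2)) u) :=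
  toL2_synth isBdd_flowLap summable_flowLap sinSeries_single u

theorem toL2_flow_eq_field (u : SqSeq Idx) : toL2 (flow u) = field (diag liftWeight u) := by
  rw [toL2_flow, field, ContinuousLinearMap.comp_apply,
    diag_diag isBdd_inv_one_add isBdd_liftWeight fun k => ?_]
  have := (one_add_beta_pos k).ne'
  rw [liftWeight]
  field_simp

theorem toL2_flowX_eq_fieldX (u : SqSeq Idx) : toL2 (flowX u) = fieldX (diag liftWeight u) := by
  rw [flowX, toL2_synth isBdd_flowX summable_flowX cosSinSeries_single, fieldX,
    ContinuousLinearMap.comp_apply, diag_diag isBdd_fst isBdd_liftWeight fst_weight_eq]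

theorem toL2_flowY_eq_fieldY (u : SqSeq Idx) : toL2 (flowY u) = fieldY (diag liftWeight u) := by
  rw [flowY, toL2_synth isBdd_flowY summable_flowY sinCosSeries_single, fieldY,
    ContinuousLinearMap.comp_apply, diag_diag isBdd_snd isBdd_liftWeight snd_weight_eq]

theorem coeFn_toL2_domain (f : BoundedContinuousFunction (ℝ × ℝ) ℝ) :
    toL2 f =ᵐ[volume.restrict domain] f := by
  have := coeFn_toL2 f
  rwa [EventuallyEq, ae_sqMeasure_eq] at this

theorem hasWeakPartialX_field (e : SqSeq Idx) : HasWeakPartialX (field e) (fieldX e) :=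
  hasWeakPartialX_series isBdd_inv_one_add isBdd_fst (fun _ => by ring) e

theorem hasWeakPartialY_field (e : SqSeq Idx) : HasWeakPartialY (field e) (fieldY e) :=
  hasWeakPartialY_series isBdd_inv_one_add isBdd_snd (fun _ => by ring) e

theorem hasWeakPartialX_flow (u : SqSeq Idx) : HasWeakPartialX (flow u) (flowX u) := by
  have := hasWeakPartialX_field (diag liftWeight u)
  rw [← toL2_flow_eq_field, ← toL2_flowX_eq_fieldX] at this
  exact this.congr (coeFn_toL2_domain _) (coeFn_toL2_domain _)

theorem hasWeakPartialY_flow (u : SqSeq Idx) : HasWeakPartialY (flow u) (flowY u) := by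
  have := hasWeakPartialY_field (diag liftWeight u)
  rw [← toL2_flow_eq_field, ← toL2_flowY_eq_fieldY] at this
  exact this.congr (coeFn_toL2_domain _) (coeFn_toL2_domain _)

/-- The bi-Laplacian of `flow u`. -/
def flowBilap : SqSeq Idx →L[ℝ] SqL2 := sinSeries.comp (diag fun k => beta k ^ 2 / (1 + beta k ^ 2))

theorem isBdd_flowBilap : IsBdd fun k : Idx => beta k ^ 2 / (1 + beta k ^ 2) :=
  isBdd_quad 0 0 1 fun k => by ring

theorem hasWeakLaplacian_flow (u : SqSeq Idx) : HasWeakLaplacian (flow u) (flowLap u) := by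
  have := hasWeakLaplacian_series isBdd_flow isBdd_flowLap (fun k => by ring) u
  rw [← toL2_flow, ← toL2_flowLap] at this
  exact this.congr (coeFn_toL2_domain _) (coeFn_toL2_domain _)

theorem hasWeakLaplacian_flowLap (u : SqSeq Idx) : HasWeakLaplacian (flowLap u) (flowBilap u) := by
  have := hasWeakLaplacian_series isBdd_flowLap isBdd_flowBilap (fun k => by ring) u
  rw [← toL2_flowLap] at this
  exact this.congr (coeFn_toL2_domain _) EventuallyEq.rfl

theorem sineCoeff_flow (u : SqSeq Idx) (k : Idx) :
    sineCoeff (flow u) k = u k / (1 + beta k ^ 2) := by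
  rw [sineCoeff, l2Inner_eq, ← coe_modeB, ← inner_toL2_toL2, real_inner_comm, ← coeffs_apply, toL2_flow,
    coeffs_sinSeries, diag_apply isBdd_flow]
  ring

theorem weighted_sineCoeff_flow (u : SqSeq Idx) (k : Idx) :
    (1 + beta k ^ 2) ^ 2 * |sineCoeff (flow u) k| ^ 2 = u k ^ 2 := by
  have := (one_add_beta_sq_pos k).ne'
  rw [sineCoeff_flow, sq_abs]
  field_simp

theorem hasSum_eval {σ : Idx → BoundedContinuousFunction (ℝ × ℝ) ℝ}
    (hs : Summable fun k => ‖σ k‖ ^ 2) (u : SqSeq Idx) (p : ℝ × ℝ) :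
    HasSum (fun k => u k * σ k p) (synth σ u p) := by
  simpa using (BoundedContinuousFunction.evalCLM ℝ p).hasSum (synth_hasSum hs u)

theorem flow_mem_H4 (u : SqSeq Idx) : ⇑(flow u) ∈ H4 := by
  refine ⟨?_, fun p => ?_⟩
  · simp only [weighted_sineCoeff_flow]
    exact u.summable_sq
  · have h := hasSum_eval summable_flow u p
    rw [← flow] at h
    convert h using 2 with k
    rw [sineCoeff_flow]
    simp only [BoundedContinuousFunction.coe_smul, modeB_apply, smul_eq_mul]
    ring

theorem h4Norm_flow (u : SqSeq Idx) : h4Norm (flow u) = ‖u‖ := by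
  rw [h4Norm]
  simp only [weighted_sineCoeff_flow]
  rw [← SqSeq.norm_sq_eq, Real.sqrt_sq (norm_nonneg _)]

theorem exists_flow_eq {ψ : ℝ × ℝ → ℝ} (h : ψ ∈ H4) :
    ∃ u : SqSeq Idx, ψ = flow u ∧ ∀ k, u k = (1 + beta k ^ 2) * sineCoeff ψ k := by
  have hs : Summable fun k => ((1 + beta k ^ 2) * sineCoeff ψ k) ^ 2 := by
    convert h.1 using 2 with k
    rw [sq_abs]
    ring
  refine ⟨SqSeq.mk _ hs, ?_, fun k => rfl⟩
  ext p
  refine (h.2 p).unique ?_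
  have h' := hasSum_eval summable_flow (SqSeq.mk _ hs) p
  rw [← flow] at h'
  convert h' using 2 with k
  have := (one_add_beta_sq_pos k).ne'
  simp only [BoundedContinuousFunction.coe_smul, modeB_apply, smul_eq_mul, SqSeq.mk_apply]
  field_simp

theorem flow_injective : Function.Injective fun u => (flow u : ℝ × ℝ → ℝ) := by
  intro u v h
  ext k
  have h1 := sineCoeff_flow u k
  have h2 := sineCoeff_flow v k
  have := (one_add_beta_sq_pos k).ne'
  rw [show (flow u : ℝ × ℝ → ℝ) = flow v from h, h2] at h1
  field_simp at h1
  exact h1.symm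

theorem synth_eq_zero_of_frontier {w : Idx → ℝ} (hs : Summable fun k => ‖w k • modeB k‖ ^ 2)
    (u : SqSeq Idx) {p : ℝ × ℝ} (hp : p ∈ frontier domain) : synth (fun k => w k • modeB k) u p = 0 := by
  have h0 : ∀ k, modeB k p = 0 := by
    intro k
    have hpi : (0 : ℝ) < 2 * Real.pi := by positivity
    have hs0 : ∀ n : ℕ+, ∀ x : ℝ, x ∈ ({0, 2 * Real.pi} : Set ℝ) → Real.sin ((n : ℝ) * x / 2) = 0 := by
      rintro n x (rfl | rfl)
      · simp
      · rw [show (n : ℝ) * (2 * Real.pi) / 2 = ((n : ℕ) : ℝ) * Real.pi by ring, Real.sin_nat_mul_pi]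
    rw [domain, frontier_prod_eq, frontier_Ioo hpi] at hp
    rw [modeB_apply, mode]
    rcases hp with ⟨-, hp⟩ | ⟨hp, -⟩
    · rw [hs0 _ _ hp, mul_zero]
    · rw [hs0 _ _ hp, zero_mul]
  refine (hasSum_eval hs u p).unique ?_
  simp [h0, hasSum_zero]

/-! ### The Jacobian -/

/-- Multiplication of an `L²` function by a bounded continuous function. -/
def mulL2 : BoundedContinuousFunction (ℝ × ℝ) ℝ →L[ℝ] SqL2 →L[ℝ] SqL2 :=
  ((ContinuousLinearMap.mul ℝ ℝ).holderL sqMeasure ⊤ 2 2).comp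
    (BoundedContinuousFunction.toLp ⊤ sqMeasure ℝ)

theorem coeFn_mulL2 (f : BoundedContinuousFunction (ℝ × ℝ) ℝ) (g : SqL2) :
    mulL2 f g =ᵐ[sqMeasure] fun p => f p * g p := by
  have h1 := (ContinuousLinearMap.mul ℝ ℝ).coeFn_holder (r := 2)
    (BoundedContinuousFunction.toLp ⊤ sqMeasure ℝ f) g
  filter_upwards [h1, BoundedContinuousFunction.coeFn_toLp ⊤ sqMeasure ℝ f] with p hp hp2
  refine hp.trans ?_
  rw [hp2]
  rfl

theorem mulL2_toL2 (f g : BoundedContinuousFunction (ℝ × ℝ) ℝ) : mulL2 f (toL2 g) = toL2 (f * g) := by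
  refine Lp.ext ?_
  filter_upwards [coeFn_mulL2 f (toL2 g), coeFn_toL2 g, coeFn_toL2 (f * g)] with p h1 h2 h3
  rw [h1, h2, h3]
  rfl

/-- The Jacobian `J(flow u, field e)` in `L²`. -/
def jacL2 : SqSeq Idx →L[ℝ] SqSeq Idx →L[ℝ] SqL2 :=
  mulL2.bilinearComp flowX fieldY - mulL2.bilinearComp flowY fieldX

theorem jacL2_apply (u e : SqSeq Idx) :
    jacL2 u e = mulL2 (flowX u) (fieldY e) - mulL2 (flowY u) (fieldX e) := rfl

/-- The sine coefficients of the Jacobian `J(flow u, field e)`. -/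
def jac : SqSeq Idx →L[ℝ] SqSeq Idx →L[ℝ] SqSeq Idx :=
  (ContinuousLinearMap.compL ℝ (SqSeq Idx) SqL2 (SqSeq Idx) coeffs).comp jacL2

theorem jac_apply (u e : SqSeq Idx) : jac u e = coeffs (jacL2 u e) := rfl

theorem coeFn_jacL2 (u e : SqSeq Idx) : jacL2 u e =ᵐ[volume.restrict domain]
    fun p => flowX u p * fieldY e p - flowY u p * fieldX e p := by
  have : jacL2 u e =ᵐ[sqMeasure]
      fun p => flowX u p * fieldY e p - flowY u p * fieldX e p := by
    rw [jacL2_apply]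
    filter_upwards [Lp.coeFn_sub (mulL2 (flowX u) (fieldY e)) (mulL2 (flowY u) (fieldX e)),
      coeFn_mulL2 (flowX u) (fieldY e), coeFn_mulL2 (flowY u) (fieldX e)] with p h1 h2 h3
    rw [h1, Pi.sub_apply, h2, h3]
  rwa [EventuallyEq, ae_sqMeasure_eq] at this

theorem hasJacobian_flow (u e : SqSeq Idx) {v : ℝ × ℝ → ℝ}
    (hv : field e =ᵐ[volume.restrict domain] v) :
    ∃ j, HasJacobian (flow u) v j ∧ j =ᵐ[volume.restrict domain] jacL2 u e :=
  ⟨_, ⟨flowX u, flowY u, fieldX e, fieldY e, hasWeakPartialX_flow u, hasWeakPartialY_flow u,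
    (hasWeakPartialX_field e).congr hv EventuallyEq.rfl,
    (hasWeakPartialY_field e).congr hv EventuallyEq.rfl, fun _ => rfl⟩, (coeFn_jacL2 u e).symm⟩

/-- The weak derivatives chosen in `HasJacobian` are arbitrary, but uniqueness identifies each a.e.
with the explicit series. -/
theorem HasJacobian.ae_eq {u e : SqSeq Idx} {v j : ℝ × ℝ → ℝ} (h : HasJacobian (flow u) v j)
    (hv : field e =ᵐ[volume.restrict domain] v) : j =ᵐ[volume.restrict domain] jacL2 u e := by
  obtain ⟨ux, uy, vx, vy, h1, h2, h3, h4, hj⟩ := h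
  have e1 := h1.unique (hasWeakPartialX_flow u) EventuallyEq.rfl
  have e2 := h2.unique (hasWeakPartialY_flow u) EventuallyEq.rfl
  have e3 := h3.unique (hasWeakPartialX_field e) hv.symm
  have e4 := h4.unique (hasWeakPartialY_field e) hv.symm
  filter_upwards [e1, e2, e3, e4, coeFn_jacL2 u e] with p p1 p2 p3 p4 p5
  rw [hj, p5, p1, p2, p3, p4]

/-- The two slots of `jac` carry different normalizations, H⁴ and H². They can be exchanged only
when both arguments are H⁴ functions, and `liftWeight` converts between the two. -/
theorem jac_antisymm (u v : SqSeq Idx) : jac u (diag liftWeight v) = - jac v (diag liftWeight u) := by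
  rw [jac_apply, jac_apply, ← map_neg]
  congr 1
  rw [jacL2_apply, jacL2_apply, ← toL2_flowX_eq_fieldX, ← toL2_flowX_eq_fieldX,
    ← toL2_flowY_eq_fieldY, ← toL2_flowY_eq_fieldY]
  simp only [mulL2_toL2]
  rw [mul_comm (flowX v), mul_comm (flowY v), neg_sub]

/-! ### Triple products of trigonometric functions -/

theorem mean_eq_zero_of_reflect {f : ℝ → ℝ} (h : ∀ x, f (2 * Real.pi - x) = - f x) : mean f = 0 := by
  have h1 := intervalIntegral.integral_comp_sub_left (a := 0) (b := 2 * Real.pi) f (2 * Real.pi)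
  simp only [h, intervalIntegral.integral_neg, sub_self, sub_zero] at h1
  rw [mean]
  have : ∫ x in (0)..(2 * Real.pi), f x = 0 := by linarith
  rw [this, mul_zero]

theorem sinB_reflect (n : ℕ+) (x : ℝ) : sinB n (2 * Real.pi - x) = -((-1) ^ (n : ℕ) * sinB n x) := by
  rw [sinB_apply, sinB_apply, ← Real.sin_nat_mul_pi_sub]
  congr 1
  ring

theorem cosB_reflect (n : ℕ+) (x : ℝ) : cosB n (2 * Real.pi - x) = (-1) ^ (n : ℕ) * cosB n x := by
  rw [cosB_apply, cosB_apply, ← Real.cos_nat_mul_pi_sub]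
  congr 1
  ring

/-- The normalized integral of `sin (j x / 2) cos (k x / 2) sin (l x / 2)`. -/
def triple (j k l : ℕ+) : ℝ := mean fun x => sinB j x * cosB k x * sinB l x

theorem triple_comm (j k l : ℕ+) : triple j k l = triple l k j := by
  rw [triple, triple]
  congr 1
  ext x
  ring

/-- Under x ↦ 2π - x the integrand is multiplied by (-1) to the power j + k + l, the extra signs of
the two sines cancelling. -/
theorem triple_eq_zero {j k l : ℕ+} (h : Odd ((j : ℕ) + k + l)) : triple j k l = 0 := by
  refine mean_eq_zero_of_reflect fun x => ?_
  rw [sinB_reflect, sinB_reflect, cosB_reflect]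
  have h1 : (-1 : ℝ) ^ ((j : ℕ) + k + l) = -1 := h.neg_one_pow
  rw [pow_add, pow_add] at h1
  linear_combination (sinB j x * cosB k x * sinB l x) * h1

/-- The integral of the derivative of a product of three sines vanishes, because sines vanish at
both endpoints. This carries the integration by parts behind the energy identity. -/
theorem triple_cyclic (j k l : ℕ+) :
    (k : ℝ) / 2 * triple j k l + (l : ℝ) / 2 * triple j l k + (j : ℝ) / 2 * triple k j l = 0 := by
  have hd : ∀ x, HasDerivAt (fun x => sinB j x * sinB k x * sinB l x)
      ((k : ℝ) / 2 * (sinB j x * cosB k x * sinB l x) + (l : ℝ) / 2 * (sinB j x * cosB l x * sinB k x)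
        + (j : ℝ) / 2 * (sinB k x * cosB j x * sinB l x)) x := by
    intro x
    have h := ((hasDerivAt_sinB j x).mul (hasDerivAt_sinB k x)).mul (hasDerivAt_sinB l x)
    refine HasDerivAt.congr_deriv (f := fun x => sinB j x * sinB k x * sinB l x) h ?_
    simp only [Pi.mul_apply]
    ring
  have hI := intervalIntegral.integral_eq_sub_of_hasDerivAt (a := 0) (b := 2 * Real.pi)
    (fun x _ => hd x) (Continuous.intervalIntegrable (by fun_prop) _ _)
  have h0 : sinB j (2 * Real.pi) = 0 := by
    rw [sinB_apply, show (j : ℝ) * (2 * Real.pi) / 2 = ((j : ℕ) : ℝ) * Real.pi by ring,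
      Real.sin_nat_mul_pi]
  have h0' : sinB j 0 = 0 := by simp
  rw [h0, h0', intervalIntegral.integral_add (Continuous.intervalIntegrable (by fun_prop) _ _)
    (Continuous.intervalIntegrable (by fun_prop) _ _),
    intervalIntegral.integral_add (Continuous.intervalIntegrable (by fun_prop) _ _)
    (Continuous.intervalIntegrable (by fun_prop) _ _), intervalIntegral.integral_const_mul,
    intervalIntegral.integral_const_mul, intervalIntegral.integral_const_mul] at hI
  simp only [triple, mean]
  linear_combination (1 / Real.pi) * hI

theorem flowX_single (k : Idx) :
    flowX (lp.single 2 k 1) = ((k.1 : ℝ) / 2 / (1 + beta k ^ 2)) • cosSinB k :=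
  synth_single summable_flowX k

theorem flowY_single (k : Idx) :
    flowY (lp.single 2 k 1) = ((k.2 : ℝ) / 2 / (1 + beta k ^ 2)) • sinCosB k :=
  synth_single summable_flowY k

theorem fieldX_single (k : Idx) :
    fieldX (lp.single 2 k 1) = ((k.1 : ℝ) / 2 / (1 + beta k)) • toL2 (cosSinB k) := by
  rw [fieldX, ContinuousLinearMap.comp_apply, diag_single isBdd_fst, map_smul, cosSinSeries_single]

theorem fieldY_single (k : Idx) :
    fieldY (lp.single 2 k 1) = ((k.2 : ℝ) / 2 / (1 + beta k)) • toL2 (sinCosB k) := by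
  rw [fieldY, ContinuousLinearMap.comp_apply, diag_single isBdd_snd, map_smul, sinCosSeries_single]

theorem inner_modeB_mul (j : Idx) (a b c d : BoundedContinuousFunction ℝ ℝ) :
    inner ℝ (toL2 (modeB j)) (toL2 (tensorB a b * tensorB c d))
      = mean (fun x => sinB j.1 x * a x * c x) * mean (fun x => sinB j.2 x * b x * d x) := by
  rw [inner_toL2_toL2, ← integral_tensor]
  refine integral_congr_ae (Eventually.of_forall fun p => ?_)
  simp only [modeB, BoundedContinuousFunction.coe_mul, Pi.mul_apply, tensorB_apply]
  ring

theorem jac_single_single (k l j : Idx) :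
    jac (lp.single 2 k 1) (lp.single 2 l 1) j = 1 / (1 + beta k ^ 2) * (1 / (1 + beta l)) *
      ((k.1 : ℝ) / 2 * ((l.2 : ℝ) / 2) * (triple j.1 k.1 l.1 * triple j.2 l.2 k.2)
        - (k.2 : ℝ) / 2 * ((l.1 : ℝ) / 2) * (triple j.1 l.1 k.1 * triple j.2 k.2 l.2)) := by
  rw [jac_apply, coeffs_apply, jacL2_apply, flowX_single, flowY_single, fieldX_single, fieldY_single]
  simp only [map_smul, smul_apply, mulL2_toL2, inner_sub_right, inner_smul_right,
    cosSinB, sinCosB, inner_modeB_mul]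
  have h1 : ∀ i k l : ℕ+, mean (fun x => sinB i x * sinB k x * cosB l x) = triple i l k := by
    intro i k l
    rw [triple]
    congr 1
    ext x
    ring
  have h2 : ∀ i k l : ℕ+, mean (fun x => sinB i x * cosB k x * sinB l x) = triple i k l :=
    fun _ _ _ => rfl
  simp only [h1, h2]
  ring

/-! ### Parity classes -/

/-- The parities of the two indices of a mode. -/
def parity (k : Idx) : ZMod 2 × ZMod 2 := (((k.1 : ℕ) : ZMod 2), ((k.2 : ℕ) : ZMod 2))

theorem odd_of_cast_ne {j k l : ℕ} (h : (j : ZMod 2) ≠ (k : ZMod 2) + (l : ZMod 2)) :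
    Odd (j + k + l) := by
  rw [← Nat.not_even_iff_odd]
  intro he
  apply h
  have h0 : ((j + k + l : ℕ) : ZMod 2) = 0 := (ZMod.natCast_eq_zero_iff_even).2 he
  push_cast at h0
  have : (j : ZMod 2) = -((k : ZMod 2) + l) := by linear_combination h0
  rw [this, ZMod.neg_eq_self_mod_two]

/-- Each term contains a triple product in x and one in y; a parity mismatch in either variable
kills one factor of both terms. -/
theorem jac_single_single_eq_zero {k l j : Idx} (h : parity j ≠ parity k + parity l) :
    jac (lp.single 2 k 1) (lp.single 2 l 1) j = 0 := by
  rw [jac_single_single]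
  have h' : ¬ (((j.1 : ℕ) : ZMod 2) = (k.1 : ℕ) + (l.1 : ℕ) ∧
      ((j.2 : ℕ) : ZMod 2) = (k.2 : ℕ) + (l.2 : ℕ)) := fun hh => h (Prod.ext hh.1 hh.2)
  rcases not_and_or.1 h' with h1 | h1
  · have h2 := odd_of_cast_ne h1
    rw [triple_eq_zero h2, triple_eq_zero (j := j.1) (k := l.1) (l := k.1) (by rwa [add_right_comm])]
    ring
  · have h2 := odd_of_cast_ne h1
    rw [triple_eq_zero h2, triple_eq_zero (j := j.2) (k := l.2) (l := k.2) (by rwa [add_right_comm])]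
    ring

theorem bilin_ext_single {F : Type*} [NormedAddCommGroup F] [NormedSpace ℝ F]
    {B C : SqSeq Idx →L[ℝ] SqSeq Idx →L[ℝ] F}
    (h : ∀ k l, B (lp.single 2 k 1) (lp.single 2 l 1) = C (lp.single 2 k 1) (lp.single 2 l 1)) :
    B = C :=
  clm_ext_single fun k => clm_ext_single fun l => h k l

/-- Sequences supported on the modes with parities in `G`. -/
def InClass (G : AddSubgroup (ZMod 2 × ZMod 2)) (u : SqSeq Idx) : Prop :=
  ∀ k, parity k ∉ G → u k = 0

open Classical in
/-- The indicator of the modes with parities in `G`. -/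
def classInd (G : AddSubgroup (ZMod 2 × ZMod 2)) (k : Idx) : ℝ := if parity k ∈ G then 1 else 0

theorem isBdd_classInd (G : AddSubgroup (ZMod 2 × ZMod 2)) : IsBdd (classInd G) :=
  ⟨1, fun k => by rw [classInd]; split_ifs <;> simp⟩

theorem diag_classInd_of_inClass {G : AddSubgroup (ZMod 2 × ZMod 2)} {u : SqSeq Idx}
    (h : InClass G u) : diag (classInd G) u = u := by
  ext k
  rw [diag_apply (isBdd_classInd G), classInd]
  split_ifs with hk
  · rw [one_mul]
  · rw [h k hk, mul_zero]

theorem inClass_diag_classInd (G : AddSubgroup (ZMod 2 × ZMod 2)) (u : SqSeq Idx) :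
    InClass G (diag (classInd G) u) := by
  intro k hk
  rw [diag_apply (isBdd_classInd G), classInd, if_neg hk, zero_mul]

theorem InClass.diag {G : AddSubgroup (ZMod 2 × ZMod 2)} {u : SqSeq Idx} (h : InClass G u)
    {d : Idx → ℝ} (hd : IsBdd d) : InClass G (diag d u) := by
  intro k hk
  rw [diag_apply hd, h k hk, mul_zero]

theorem InClass.add {G : AddSubgroup (ZMod 2 × ZMod 2)} {u v : SqSeq Idx} (hu : InClass G u)
    (hv : InClass G v) : InClass G (u + v) := by
  intro k hk
  rw [lp.coeFn_add, Pi.add_apply, hu k hk, hv k hk, add_zero]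

theorem InClass.smul {G : AddSubgroup (ZMod 2 × ZMod 2)} {u : SqSeq Idx} (hu : InClass G u)
    (c : ℝ) : InClass G (c • u) := by
  intro k hk
  rw [lp.coeFn_smul, Pi.smul_apply, hu k hk, smul_zero]

theorem InClass.neg {G : AddSubgroup (ZMod 2 × ZMod 2)} {u : SqSeq Idx} (hu : InClass G u) :
    InClass G (-u) := by
  intro k hk
  rw [lp.coeFn_neg, Pi.neg_apply, hu k hk, neg_zero]

theorem InClass.sub {G : AddSubgroup (ZMod 2 × ZMod 2)} {u v : SqSeq Idx} (hu : InClass G u)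
    (hv : InClass G v) : InClass G (u - v) := by
  rw [sub_eq_add_neg]
  exact hu.add hv.neg

/-- Parities add under the Jacobian, so closure needs a subgroup of parities rather than one parity
class. -/
theorem InClass.jac {G : AddSubgroup (ZMod 2 × ZMod 2)} {u e : SqSeq Idx} (hu : InClass G u)
    (he : InClass G e) : InClass G (jac u e) := by
  intro j hj
  -- The j-th coefficient, precomposed with the class projections, is a continuous bilinear form; it
  -- vanishes on pairs of unit vectors, hence identically.
  have hz : (ContinuousLinearMap.compL ℝ (SqSeq Idx) (SqSeq Idx) ℝ
      (lp.evalCLM ℝ (fun _ : Idx => ℝ) 2 j)).comp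
      (VortexFlow.jac.bilinearComp (VortexFlow.diag (classInd G)) (VortexFlow.diag (classInd G))) = 0 := by
    refine bilin_ext_single fun k l => ?_
    change VortexFlow.jac (VortexFlow.diag (classInd G) (lp.single 2 k 1))
      (VortexFlow.diag (classInd G) (lp.single 2 l 1)) j = 0
    rw [diag_single (isBdd_classInd G), diag_single (isBdd_classInd G)]
    simp only [map_smul, smul_apply, lp.coeFn_smul, Pi.smul_apply, smul_eq_mul]
    by_cases hk : parity k ∈ G
    · by_cases hl : parity l ∈ G
      · rw [jac_single_single_eq_zero, mul_zero, mul_zero]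
        exact fun h => hj (h ▸ G.add_mem hk hl)
      · simp [classInd, hl]
    · simp [classInd, hk]
  have := DFunLike.congr_fun (DFunLike.congr_fun hz u) e
  change VortexFlow.jac (VortexFlow.diag (classInd G) u) (VortexFlow.diag (classInd G) e) j = 0 at this
  rwa [diag_classInd_of_inClass hu, diag_classInd_of_inClass he] at this

/-! ### The linearized operator -/

/-- The coefficients of the basic flow `sin x sin y`. -/
def basic : SqSeq Idx := (5 : ℝ) • lp.single 2 ((2 : ℕ+), (2 : ℕ+)) 1

theorem beta_two_two : beta ((2 : ℕ+), (2 : ℕ+)) = 2 := by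
  rw [beta]
  push_cast
  norm_num

theorem flow_basic : ⇑(flow basic) = psi0 := by
  ext p
  -- The factor 5 in `basic` is 1 + β² at (2,2), where β = 2, and cancels the normalization.
  rw [basic, map_smul, flow, synth_single summable_flow, beta_two_two]
  simp only [BoundedContinuousFunction.coe_smul, modeB_apply, mode, psi0, smul_eq_mul]
  push_cast
  rw [show (2 : ℝ) * p.1 / 2 = p.1 by ring, show (2 : ℝ) * p.2 / 2 = p.2 by ring]
  ring

theorem parity_two_two : parity ((2 : ℕ+), (2 : ℕ+)) = 0 := by decide

theorem inClass_basic (G : AddSubgroup (ZMod 2 × ZMod 2)) : InClass G basic := by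
  intro k hk
  have : k ≠ ((2 : ℕ+), (2 : ℕ+)) := by
    rintro rfl
    rw [parity_two_two] at hk
    exact hk G.zero_mem
  rw [basic, lp.coeFn_smul, Pi.smul_apply, lp.single_apply, Pi.single_eq_of_ne this, smul_zero]

/-- ψ₀ has parity (0,0), so J(ψ₀, ·) preserves the parity of each mode and commutes with any weight
depending on parity alone. -/
theorem diag_parity_jac_basic {f : ZMod 2 × ZMod 2 → ℝ} (hf : IsBdd fun k => f (parity k))
    (e : SqSeq Idx) : jac basic (diag (fun k => f (parity k)) e)
      = diag (fun k => f (parity k)) (jac basic e) := by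
  have : (jac basic).comp (diag fun k => f (parity k))
      = (diag fun k => f (parity k)).comp (jac basic) := by
    refine clm_ext_single fun l => ?_
    simp only [ContinuousLinearMap.comp_apply, diag_single hf, map_smul, basic, smul_apply]
    ext j
    simp only [lp.coeFn_smul, Pi.smul_apply, smul_eq_mul, diag_apply hf]
    by_cases h : parity j = parity l
    · rw [h]; ring
    · rw [jac_single_single_eq_zero (by rwa [parity_two_two, zero_add])]
      ring
  exact DFunLike.congr_fun this e

/-- The weight of the viscous terms `-s Δ + ν Δ²`. -/
def viscWeight (s ν : ℝ) (k : Idx) : ℝ := beta k * (s + ν * beta k) / (1 + beta k ^ 2)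

theorem isBdd_viscWeight (s ν : ℝ) : IsBdd (viscWeight s ν) :=
  isBdd_quad 0 s ν fun k => by rw [viscWeight]; ring

/-- The viscous terms `-s Δ + ν Δ²`. -/
def visc (s ν : ℝ) : SqSeq Idx →L[ℝ] SqSeq Idx := diag (viscWeight s ν)

/-- The weight of `2 + Δ`. -/
def twoAddLapWeight (k : Idx) : ℝ := (2 - beta k) * (1 + beta k) / (1 + beta k ^ 2)

theorem isBdd_twoAddLapWeight : IsBdd twoAddLapWeight :=
  isBdd_quad 2 1 (-1) fun k => by rw [twoAddLapWeight]; ring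

/-- The weight of `Δ`. -/
def lapWeight (k : Idx) : ℝ := -(beta k * (1 + beta k)) / (1 + beta k ^ 2)

theorem isBdd_lapWeight : IsBdd lapWeight :=
  isBdd_quad 0 (-1) (-1) fun k => by rw [lapWeight]; ring

/-- The advection term `J(ψ₀, (2 + Δ) ψ)`. -/
def advect : SqSeq Idx →L[ℝ] SqSeq Idx := (jac basic).comp (diag twoAddLapWeight)

/-- The linearized operator `-s Δ ψ + ν Δ² ψ + J(ψ₀, (2 + Δ) ψ)`. -/
def linOp (s ν : ℝ) : SqSeq Idx →L[ℝ] SqSeq Idx := visc s ν + advect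

theorem linOp_apply (s ν : ℝ) (u : SqSeq Idx) : linOp s ν u = visc s ν u + advect u := rfl

theorem advect_apply (u : SqSeq Idx) : advect u = jac basic (diag twoAddLapWeight u) := rfl

theorem InClass.advect {G : AddSubgroup (ZMod 2 × ZMod 2)} {u : SqSeq Idx} (hu : InClass G u) :
    InClass G (advect u) :=
  (inClass_basic G).jac (hu.diag isBdd_twoAddLapWeight)

theorem InClass.visc {G : AddSubgroup (ZMod 2 × ZMod 2)} {u : SqSeq Idx} (hu : InClass G u)
    (s ν : ℝ) : InClass G (visc s ν u) :=
  hu.diag (isBdd_viscWeight s ν)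

theorem field_lap (u : SqSeq Idx) : field (diag lapWeight u) = toL2 (flowLap u) := by
  rw [toL2_flowLap, field, ContinuousLinearMap.comp_apply,
    diag_diag isBdd_inv_one_add isBdd_lapWeight fun k => ?_]
  have := (one_add_beta_pos k).ne'
  rw [lapWeight]
  field_simp

theorem diag_two_add_lap (u : SqSeq Idx) :
    diag twoAddLapWeight u = (2 : ℝ) • diag liftWeight u + diag lapWeight u := by
  ext k
  simp only [lp.coeFn_add, lp.coeFn_smul, Pi.add_apply, Pi.smul_apply, smul_eq_mul,
    diag_apply isBdd_twoAddLapWeight, diag_apply isBdd_liftWeight, diag_apply isBdd_lapWeight,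
    twoAddLapWeight, liftWeight, lapWeight]
  ring

theorem coeFn_field_two_add_lap (u : SqSeq Idx) : field (diag twoAddLapWeight u)
    =ᵐ[volume.restrict domain] fun p => 2 * flow u p + flowLap u p := by
  have : field (diag twoAddLapWeight u) = toL2 ((2 : ℝ) • flow u + flowLap u) := by
    rw [diag_two_add_lap, map_add, map_smul, ← toL2_flow_eq_field, field_lap, map_add, map_smul]
  rw [this]
  exact coeFn_toL2_domain _

theorem coeFn_field_lap (u : SqSeq Idx) :
    field (diag lapWeight u) =ᵐ[volume.restrict domain] flowLap u := by
  rw [field_lap]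
  exact coeFn_toL2_domain _

/-- An equation between `L²` functions, in terms of sine coefficients. -/
theorem coeffs_add_visc_eq_zero_iff (s ν : ℝ) (F : SqL2) (v : SqSeq Idx) :
    coeffs F + visc s ν v = 0 ↔ ∀ᵐ p ∂(volume.restrict domain),
      F p + (-s * flowLap v p + ν * flowBilap v p) = 0 := by
  have hX : coeffs F + visc s ν v
      = coeffs (F + ((-s) • toL2 (flowLap v) + ν • flowBilap v)) := by
    rw [map_add, map_add, map_smul, map_smul, toL2_flowLap, flowBilap, ContinuousLinearMap.comp_apply,
      coeffs_sinSeries, coeffs_sinSeries, visc]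
    congr 1
    ext k
    simp only [lp.coeFn_add, lp.coeFn_smul, Pi.add_apply, Pi.smul_apply, smul_eq_mul,
      diag_apply isBdd_flowLap, diag_apply isBdd_flowBilap, diag_apply (isBdd_viscWeight s ν), viscWeight]
    ring
  have hae : ⇑(F + ((-s) • toL2 (flowLap v) + ν • flowBilap v)) =ᵐ[sqMeasure]
      fun p => F p + (-s * flowLap v p + ν * flowBilap v p) := by
    filter_upwards [Lp.coeFn_add F ((-s) • toL2 (flowLap v) + ν • flowBilap v),
      Lp.coeFn_add ((-s) • toL2 (flowLap v)) (ν • flowBilap v),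
      Lp.coeFn_smul (-s) (toL2 (flowLap v)), Lp.coeFn_smul ν (flowBilap v),
      coeFn_toL2 (flowLap v)] with p h1 h2 h3 h4 h5
    rw [h1, Pi.add_apply, h2, Pi.add_apply, h3, h4, Pi.smul_apply, Pi.smul_apply, h5, smul_eq_mul,
      smul_eq_mul]
  rw [hX, ← ae_sqMeasure_eq]
  constructor
  · intro h
    have h0 : F + ((-s) • toL2 (flowLap v) + ν • flowBilap v) = 0 := by
      rw [← sinSeries_coeffs (F + _), h, map_zero]
    rw [h0] at hae
    filter_upwards [hae, Lp.coeFn_zero ℝ 2 sqMeasure] with p h1 h2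
    rw [← h1, h2, Pi.zero_apply]
  · intro h
    have h0 : F + ((-s) • toL2 (flowLap v) + ν • flowBilap v) = 0 := by
      refine Lp.ext ?_
      filter_upwards [hae, h, Lp.coeFn_zero ℝ 2 sqMeasure] with p h1 h2 h3
      rw [h1, h2, h3, Pi.zero_apply]
    rw [h0, map_zero]

/-- Uniqueness of weak derivatives replaces Δψ, Δ²ψ and the Jacobian by their series a.e.
Completeness of the modes then turns the a.e. equation into an equation of coefficients, in which λ
and μ enter only through their sum. -/
theorem isEigenfunction_flow_iff (lam ν μ : ℝ) (u : SqSeq Idx) :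
    IsEigenfunction lam ν μ (flow u) ↔ u ≠ 0 ∧ linOp (lam + μ) ν u = 0 := by
  have hne : (flow u : ℝ × ℝ → ℝ) ≠ 0 ↔ u ≠ 0 := by
    refine not_congr ⟨fun h => flow_injective ?_, fun h => ?_⟩
    · change (flow u : ℝ × ℝ → ℝ) = flow 0
      rw [h, map_zero]
      rfl
    · rw [h, map_zero]
      rfl
  have hop : linOp (lam + μ) ν u = 0 ↔ ∀ᵐ p ∂(volume.restrict domain),
      jacL2 basic (diag twoAddLapWeight u) p
        + (-(lam + μ) * flowLap u p + ν * flowBilap u p) = 0 := by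
    rw [← coeffs_add_visc_eq_zero_iff, linOp_apply, add_comm]
    rfl
  rw [hop, ← hne]
  constructor
  · rintro ⟨-, h0, w, z, j, hw, hz, hj, heq⟩
    refine ⟨h0, ?_⟩
    have hw' := hw.unique (hasWeakLaplacian_flow u) EventuallyEq.rfl
    have hz' := hz.unique (hasWeakLaplacian_flowLap u) hw'
    rw [← flow_basic] at hj
    have hj' := hj.ae_eq (e := diag twoAddLapWeight u) (by
      filter_upwards [coeFn_field_two_add_lap u, hw'] with p h1 h2
      rw [h1, h2])
    filter_upwards [heq, hw', hz', hj'] with p h1 h2 h3 h4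
    rw [h2, h3, h4] at h1
    linarith
  · rintro ⟨h0, h⟩
    obtain ⟨j, hj, hj'⟩ := hasJacobian_flow basic (diag twoAddLapWeight u) (coeFn_field_two_add_lap u)
    rw [flow_basic] at hj
    refine ⟨flow_mem_H4 u, h0, flowLap u, flowBilap u, j, hasWeakLaplacian_flow u,
      hasWeakLaplacian_flowLap u, hj, ?_⟩
    filter_upwards [h, hj'] with p h1 h2
    rw [h2]
    linarith

/-! ### The energy identity -/

/-- The weight 1/(1 + β) undoes the normalization of the second slot, so this is skewness of J(ψ_k,
·) in L². It reduces to the identity `triple_cyclic` in each variable. -/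
theorem inner_jac_single (k l j : Idx) :
    inner ℝ (jac (lp.single 2 k 1) (lp.single 2 l 1))
        (diag (fun k : Idx => 1 / (1 + beta k)) (lp.single 2 j 1))
      = -inner ℝ (jac (lp.single 2 k 1) (lp.single 2 j 1))
        (diag (fun k : Idx => 1 / (1 + beta k)) (lp.single 2 l 1)) := by
  rw [diag_single isBdd_inv_one_add, diag_single isBdd_inv_one_add, inner_smul_right,
    inner_smul_right, lp.inner_single_right, lp.inner_single_right, jac_single_single,
    jac_single_single]
  have c1 := triple_cyclic j.1 k.1 l.1
  have c2 := triple_cyclic j.2 k.2 l.2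
  rw [triple_comm k.1 j.1 l.1] at c1
  rw [triple_comm k.2 j.2 l.2] at c2
  rw [triple_comm l.1 k.1 j.1, triple_comm l.2 k.2 j.2]
  simp only [RCLike.inner_apply, conj_trivial]
  linear_combination (1 / (1 + beta j) * (1 / (1 + beta k ^ 2)) * (1 / (1 + beta l))) *
    ((k.1 : ℝ) / 2 * triple j.1 k.1 l.1 * c2 - (k.2 : ℝ) / 2 * triple j.2 k.2 l.2 * c1)

/-- Extends the identity on unit vectors by linearity and continuity, one slot at a time. -/
theorem inner_jac_basic_antisymm (e f : SqSeq Idx) :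
    inner ℝ (jac basic e) (diag (fun k : Idx => 1 / (1 + beta k)) f)
      = -inner ℝ (jac basic f) (diag (fun k : Idx => 1 / (1 + beta k)) e) := by
  have h0 : ∀ l j : Idx, inner ℝ (jac basic (lp.single 2 l 1))
        (diag (fun k : Idx => 1 / (1 + beta k)) (lp.single 2 j 1))
      = -inner ℝ (jac basic (lp.single 2 j 1))
        (diag (fun k : Idx => 1 / (1 + beta k)) (lp.single 2 l 1)) := by
    intro l j
    rw [basic, map_smul, smul_apply, smul_apply, inner_smul_left, inner_smul_left, inner_jac_single]
    simp
  have h1 : ∀ (l : Idx) (f : SqSeq Idx), inner ℝ (jac basic (lp.single 2 l 1))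
        (diag (fun k : Idx => 1 / (1 + beta k)) f)
      = -inner ℝ (jac basic f) (diag (fun k : Idx => 1 / (1 + beta k)) (lp.single 2 l 1)) := by
    intro l f
    have : (innerSL ℝ (jac basic (lp.single 2 l 1))).comp (diag fun k : Idx => 1 / (1 + beta k))
        = -((innerSL ℝ (diag (fun k : Idx => 1 / (1 + beta k)) (lp.single 2 l 1))).comp (jac basic)) :=
      clm_ext_single fun j => by
        simp only [neg_apply, ContinuousLinearMap.comp_apply, innerSL_apply_apply]
        rw [h0, real_inner_comm]
    have := DFunLike.congr_fun this f
    simp only [neg_apply, ContinuousLinearMap.comp_apply, innerSL_apply_apply] at this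
    rw [this, real_inner_comm]
  have : (innerSL ℝ (diag (fun k : Idx => 1 / (1 + beta k)) f)).comp (jac basic)
      = -((innerSL ℝ (jac basic f)).comp (diag fun k : Idx => 1 / (1 + beta k))) :=
    clm_ext_single fun l => by
      simp only [neg_apply, ContinuousLinearMap.comp_apply, innerSL_apply_apply]
      rw [← h1, real_inner_comm]
  have := DFunLike.congr_fun this e
  simp only [neg_apply, ContinuousLinearMap.comp_apply, innerSL_apply_apply] at this
  rw [real_inner_comm, this]

/-- The weight of `2 + Δ` in `L²`. -/
def energyWeight (k : Idx) : ℝ := (2 - beta k) / (1 + beta k ^ 2)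

theorem isBdd_energyWeight : IsBdd energyWeight :=
  isBdd_quad 2 (-1) 0 fun k => by rw [energyWeight]; ring

/-- The indefinite quadratic form `((-s Δ + ν Δ²) u, (2 + Δ) v)`. -/
def energy (s ν : ℝ) (u v : SqSeq Idx) : ℝ := inner ℝ (visc s ν u) (diag energyWeight v)

theorem energy_eq_tsum (s ν : ℝ) (u v : SqSeq Idx) :
    energy s ν u v = ∑' k, viscWeight s ν k * energyWeight k * (u k * v k) := by
  rw [energy, lp.inner_eq_tsum]
  refine tsum_congr fun k => ?_
  rw [visc, diag_apply (isBdd_viscWeight s ν), diag_apply isBdd_energyWeight]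
  simp only [RCLike.inner_apply, conj_trivial]
  ring

theorem energy_comm (s ν : ℝ) (u v : SqSeq Idx) : energy s ν u v = energy s ν v u := by
  rw [energy_eq_tsum, energy_eq_tsum]
  exact tsum_congr fun k => by ring

/-- Advection is J(ψ₀, ·) applied to (2 + Δ)u, so pairing it with (2 + Δ)v is the skew form
evaluated at (2 + Δ)u and (2 + Δ)v. -/
theorem inner_advect_antisymm (u v : SqSeq Idx) :
    inner ℝ (advect u) (diag energyWeight v) = -inner ℝ (advect v) (diag energyWeight u) := by
  have h : ∀ w, diag energyWeight w
      = diag (fun k : Idx => 1 / (1 + beta k)) (diag twoAddLapWeight w) := by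
    intro w
    rw [diag_diag isBdd_inv_one_add isBdd_twoAddLapWeight fun k => ?_]
    have := (one_add_beta_pos k).ne'
    rw [energyWeight, twoAddLapWeight]
    field_simp
  rw [h, h, advect_apply, advect_apply, inner_jac_basic_antisymm]

theorem inner_linOp (s ν : ℝ) (u v : SqSeq Idx) : inner ℝ (linOp s ν u) (diag energyWeight v)
    = energy s ν u v + inner ℝ (advect u) (diag energyWeight v) := by
  rw [linOp_apply, inner_add_left, energy]

theorem inner_linOp_self (s ν : ℝ) (u : SqSeq Idx) :
    inner ℝ (linOp s ν u) (diag energyWeight u) = energy s ν u u := by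
  have := inner_advect_antisymm u u
  rw [inner_linOp]
  linarith

theorem two_lt_beta {k : Idx} (h1 : k ≠ (1, 1)) (h2 : k ≠ (1, 2)) (h3 : k ≠ (2, 1))
    (h4 : k ≠ (2, 2)) : 2 < beta k := by
  obtain ⟨n, m⟩ := k
  have key : 8 < (n : ℕ) ^ 2 + (m : ℕ) ^ 2 := by
    have hn := n.pos
    have hm := m.pos
    by_contra hle
    have hn3 : (n : ℕ) < 3 := by nlinarith
    have hm3 : (m : ℕ) < 3 := by nlinarith
    have hn' : n = 1 ∨ n = 2 := by
      rcases (by omega : (n : ℕ) = 1 ∨ (n : ℕ) = 2) with h | h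
      · exact Or.inl (PNat.coe_injective h)
      · exact Or.inr (PNat.coe_injective h)
    have hm' : m = 1 ∨ m = 2 := by
      rcases (by omega : (m : ℕ) = 1 ∨ (m : ℕ) = 2) with h | h
      · exact Or.inl (PNat.coe_injective h)
      · exact Or.inr (PNat.coe_injective h)
    rcases hn' with rfl | rfl <;> rcases hm' with rfl | rfl <;> simp_all
  have key' : (8 : ℝ) < (n : ℝ) ^ 2 + (m : ℝ) ^ 2 := by exact_mod_cast key
  rw [beta]
  simp only
  linarith

/-- The least value of β is 1/2, attained at (1,1); this is the role of the hypothesis λ + μ + ν/2 >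
0. -/
theorem viscWeight_pos {s ν : ℝ} (hν : 0 < ν) (hs : 0 < s + ν / 2) (k : Idx) :
    0 < viscWeight s ν k := by
  have : 0 < s + ν * beta k := by nlinarith [half_le_beta k]
  have := beta_pos k
  rw [viscWeight]
  positivity

theorem visc_eq_zero {s ν : ℝ} (hν : 0 < ν) (hs : 0 < s + ν / 2) {u : SqSeq Idx}
    (h : visc s ν u = 0) : u = 0 := by
  ext k
  have h1 : visc s ν u k = 0 := by rw [h]; rfl
  rw [visc, diag_apply (isBdd_viscWeight s ν)] at h1
  exact (mul_eq_zero.1 h1).resolve_left (viscWeight_pos hν hs k).ne'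

/-- With the three positive terms absent, every term of the energy sum is nonpositive, so each one
is zero. The term (2,2) carries no information because 2 - β vanishes there. -/
theorem eq_zero_of_energy_eq_zero {s ν : ℝ} (hν : 0 < ν) (hs : 0 < s + ν / 2) {u : SqSeq Idx}
    (h : energy s ν u u = 0) (h1 : u (1, 1) = 0) (h2 : u (1, 2) = 0) (h3 : u (2, 1) = 0)
    {k : Idx} (hk : k ≠ (2, 2)) : u k = 0 := by
  have hw : ∀ k : Idx, k ≠ (1, 1) → k ≠ (1, 2) → k ≠ (2, 1) → k ≠ (2, 2) → energyWeight k < 0 := by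
    intro k a b c d
    have := two_lt_beta a b c d
    exact div_neg_of_neg_of_pos (by linarith) (one_add_beta_sq_pos k)
  have h22 : energyWeight (2, 2) = 0 := by rw [energyWeight, beta_two_two]; simp
  have hnn : ∀ k, 0 ≤ -(viscWeight s ν k * energyWeight k * (u k * u k)) := by
    intro k
    by_cases a : k = (1, 1)
    · simp [a, h1]
    by_cases b : k = (1, 2)
    · simp [b, h2]
    by_cases c : k = (2, 1)
    · simp [c, h3]
    by_cases d : k = (2, 2)
    · simp [d, h22]
    have h5 := viscWeight_pos hν hs k
    have h6 := hw k a b c d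
    nlinarith [mul_pos h5 (neg_pos.2 h6), mul_self_nonneg (u k)]
  have hsum : HasSum (fun k => -(viscWeight s ν k * energyWeight k * (u k * u k))) 0 := by
    have hs : Summable fun k => viscWeight s ν k * energyWeight k * (u k * u k) := by
      refine (lp.summable_inner (𝕜 := ℝ) (visc s ν u) (diag energyWeight u)).congr fun k => ?_
      rw [visc, diag_apply (isBdd_viscWeight s ν), diag_apply isBdd_energyWeight]
      simp only [RCLike.inner_apply, conj_trivial]
      ring
    have := hs.hasSum.neg
    rwa [← energy_eq_tsum, h, neg_zero] at this
  have h0 := congr_fun ((hasSum_zero_iff_of_nonneg hnn).1 hsum) k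
  by_cases a : k = (1, 1)
  · rw [a, h1]
  by_cases b : k = (1, 2)
  · rw [b, h2]
  by_cases c : k = (2, 1)
  · rw [c, h3]
  have h5 := (viscWeight_pos hν hs k).ne'
  have h6 := (hw k a b c hk).ne
  simpa [h5, h6] using h0

theorem advect_eq_zero {u : SqSeq Idx} (h : ∀ k : Idx, k ≠ (2, 2) → u k = 0) : advect u = 0 := by
  have : diag twoAddLapWeight u = 0 := by
    ext k
    rw [diag_apply isBdd_twoAddLapWeight]
    by_cases hk : k = (2, 2)
    · rw [hk, twoAddLapWeight, beta_two_two]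
      simp
    · rw [h k hk, mul_zero]
      rfl
  rw [advect_apply, this, map_zero]

/-- The kernel of the linearized operator is determined by three coefficients. -/
theorem linOp_eq_zero {s ν : ℝ} (hν : 0 < ν) (hs : 0 < s + ν / 2) {u : SqSeq Idx}
    (h : linOp s ν u = 0) (h1 : u (1, 1) = 0) (h2 : u (1, 2) = 0) (h3 : u (2, 1) = 0) : u = 0 := by
  -- Pairing with (2 + Δ)u removes the skew advection term.
  have hE : energy s ν u u = 0 := by rw [← inner_linOp_self, h, inner_zero_left]
  -- Only the mode (2,2) may remain. It lies in the kernel of 2 + Δ, so the equation reduces to the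
  -- injective viscous part.
  have hA := advect_eq_zero fun k hk => eq_zero_of_energy_eq_zero hν hs hE h1 h2 h3 hk
  rw [linOp_apply, hA, add_zero] at h
  exact visc_eq_zero hν hs h

/-! ### The spectral problem -/

/-- `flow` as a linear map into functions. -/
def flowFun : SqSeq Idx →ₗ[ℝ] (ℝ × ℝ → ℝ) where
  toFun u := flow u
  map_add' u v := by rw [map_add]; rfl
  map_smul' c u := by rw [map_smul]; rfl

/-- The three coefficients that determine an eigenfunction. -/
def leadingCoeffs : SqSeq Idx →ₗ[ℝ] (Fin 3 → ℝ) where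
  toFun u := ![u (1, 1), u (1, 2), u (2, 1)]
  map_add' u v := by ext i; fin_cases i <;> rfl
  map_smul' c u := by ext i; fin_cases i <;> rfl

/-- Reading off the three leading coefficients is injective on the kernel, so it preserves linear
independence. -/
theorem card_le_three {lam ν μ : ℝ} (hν : 0 < ν) (h : 0 < lam + μ + ν / 2) {k : ℕ}
    {v : Fin k → (ℝ × ℝ → ℝ)} (hv : ∀ j, IsEigenfunction lam ν μ (v j))
    (hli : LinearIndependent ℝ v) : k ≤ 3 := by
  choose u hu _ using fun j => exists_flow_eq (hv j).1
  have hu0 : ∀ j, linOp (lam + μ) ν (u j) = 0 := fun j =>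
    ((isEigenfunction_flow_iff lam ν μ (u j)).1 (hu j ▸ hv j)).2
  have hli' : LinearIndependent ℝ u := by
    refine LinearIndependent.of_comp flowFun ?_
    convert hli using 1
    ext1 j
    exact (hu j).symm
  have hli3 : LinearIndependent ℝ (leadingCoeffs ∘ u) := by
    rw [Fintype.linearIndependent_iff] at hli' ⊢
    intro g hg
    refine hli' g ?_
    simp only [Function.comp_apply, ← map_smul, ← map_sum] at hg
    refine linOp_eq_zero hν h ?_ (congr_fun hg 0) (congr_fun hg 1) (congr_fun hg 2)
    simp [map_sum, hu0]
  simpa using hli3.fintype_card_le_finrank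

/-- The indicator of one pair of parities. -/
def parityInd (a : ZMod 2 × ZMod 2) (k : Idx) : ℝ := if parity k = a then 1 else 0

theorem isBdd_parityInd (a : ZMod 2 × ZMod 2) : IsBdd (parityInd a) :=
  ⟨1, fun k => by rw [parityInd]; split_ifs <;> simp⟩

theorem diag_comm {d e : Idx → ℝ} (hd : IsBdd d) (he : IsBdd e) (u : SqSeq Idx) :
    diag d (diag e u) = diag e (diag d u) := by
  rw [diag_diag hd he fun _ => rfl, diag_diag he hd fun _ => mul_comm _ _]

theorem linOp_diag_parityInd (s ν : ℝ) (a : ZMod 2 × ZMod 2) (u : SqSeq Idx) :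
    linOp s ν (diag (parityInd a) u) = diag (parityInd a) (linOp s ν u) := by
  rw [linOp_apply, linOp_apply, map_add, advect_apply, advect_apply, visc,
    diag_comm (isBdd_viscWeight s ν) (isBdd_parityInd a),
    diag_comm isBdd_twoAddLapWeight (isBdd_parityInd a)]
  congr 1
  exact diag_parity_jac_basic (f := fun b => if b = a then 1 else 0) (isBdd_parityInd a) _

theorem parity_eq_iff (n m : ℕ+) (a b : ZMod 2) :
    parity (n, m) = (a, b) ↔ ((n : ℕ) : ZMod 2) = a ∧ ((m : ℕ) : ZMod 2) = b := Prod.ext_iff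

theorem sineCoeff_flow_eq_zero {u : SqSeq Idx} {k : Idx} (h : u k = 0) :
    sineCoeff (flow u) k = 0 := by
  rw [sineCoeff_flow, h, zero_div]

/-- Each parity component of a kernel element is again in the kernel, and three of the four classes
are the Eᵢ. A component may be zero, and is then not an eigenfunction. -/
theorem eigenfunction_mem_span {lam ν μ : ℝ} (hν : 0 < ν) (h : 0 < lam + μ + ν / 2)
    {ψ : ℝ × ℝ → ℝ} (hψ : IsEigenfunction lam ν μ ψ) :
    ψ ∈ Submodule.span ℝ {φ | IsEigenfunction lam ν μ φ ∧ φ ∈ E₁ ∪ E₂ ∪ E₃} := by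
  obtain ⟨u, rfl, -⟩ := exists_flow_eq hψ.1
  obtain ⟨-, hu⟩ := (isEigenfunction_flow_iff lam ν μ u).1 hψ
  have hker : ∀ a, linOp (lam + μ) ν (diag (parityInd a) u) = 0 := fun a => by
    rw [linOp_diag_parityInd, hu, map_zero]
  have hval : ∀ a k, diag (parityInd a) u k = if parity k = a then u k else 0 := fun a k => by
    rw [diag_apply (isBdd_parityInd a), parityInd]
    split_ifs <;> simp
  -- None of the three leading modes is even-even.
  have h00 : diag (parityInd (0, 0)) u = 0 := by
    refine linOp_eq_zero hν h (hker _) ?_ ?_ ?_ <;>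
      exact (hval _ _).trans (if_neg (by decide))
  have hsum : u = diag (parityInd (1, 1)) u + diag (parityInd (1, 0)) u
      + diag (parityInd (0, 1)) u := by
    ext k
    simp only [lp.coeFn_add, Pi.add_apply, hval]
    have h0 : diag (parityInd (0, 0)) u k = 0 := by rw [h00]; rfl
    rw [hval] at h0
    generalize parity k = q at h0 ⊢
    revert h0
    revert q
    have hq : ∀ q : ZMod 2 × ZMod 2, q = (0, 0) ∨ q = (1, 1) ∨ q = (1, 0) ∨ q = (0, 1) := by decide
    intro q
    rcases hq q with rfl | rfl | rfl | rfl <;> simp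
  have hmem : ∀ a, (flow (diag (parityInd a) u) : ℝ × ℝ → ℝ) ∈ E₁ ∪ E₂ ∪ E₃ →
      (flow (diag (parityInd a) u) : ℝ × ℝ → ℝ) ∈
        Submodule.span ℝ {φ | IsEigenfunction lam ν μ φ ∧ φ ∈ E₁ ∪ E₂ ∪ E₃} := by
    intro a ha
    by_cases h0 : diag (parityInd a) u = 0
    · rw [h0, map_zero]
      exact Submodule.zero_mem _
    · exact Submodule.subset_span ⟨(isEigenfunction_flow_iff _ _ _ _).2 ⟨h0, hker a⟩, ha⟩
  have hadd : (flow u : ℝ × ℝ → ℝ) = flow (diag (parityInd (1, 1)) u)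
      + flow (diag (parityInd (1, 0)) u) + flow (diag (parityInd (0, 1)) u) := by
    conv_lhs => rw [hsum]
    rw [map_add, map_add]
    rfl
  rw [hadd]
  refine Submodule.add_mem _ (Submodule.add_mem _ (hmem _ ?_) (hmem _ ?_)) (hmem _ ?_)
  · refine Or.inl (Or.inl ⟨flow_mem_H4 _, fun n m hnm => sineCoeff_flow_eq_zero ?_⟩)
    rw [hval, if_neg]
    rw [parity_eq_iff, ZMod.natCast_eq_one_iff_odd, ZMod.natCast_eq_one_iff_odd]
    exact hnm
  · refine Or.inl (Or.inr ⟨flow_mem_H4 _, fun n m hnm => sineCoeff_flow_eq_zero ?_⟩)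
    rw [hval, if_neg]
    rw [parity_eq_iff, ZMod.natCast_eq_one_iff_odd, ZMod.natCast_eq_zero_iff_even]
    exact hnm
  · refine Or.inr ⟨flow_mem_H4 _, fun n m hnm => sineCoeff_flow_eq_zero ?_⟩
    rw [hval, if_neg]
    rw [parity_eq_iff, ZMod.natCast_eq_zero_iff_even, ZMod.natCast_eq_one_iff_odd]
    exact hnm

/-! ### The bifurcation equation -/

/-- The weighted `L²` pairing of `flow u` and `flow v`. -/
def pairing (u : SqSeq Idx) : SqSeq Idx →L[ℝ] ℝ :=
  (innerSL ℝ (diag (fun k => 1 / (1 + beta k ^ 2)) u)).comp (diag fun k => 1 / (1 + beta k ^ 2))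

theorem pairing_apply (u v : SqSeq Idx) : pairing u v =
    inner ℝ (diag (fun k => 1 / (1 + beta k ^ 2)) u) (diag (fun k => 1 / (1 + beta k ^ 2)) v) := rfl

theorem l2Inner_flow (u v : SqSeq Idx) : l2Inner (flow u) (flow v) = pairing u v := by
  rw [l2Inner_eq, ← inner_toL2_toL2, toL2_flow, toL2_flow, inner_sinSeries, pairing_apply]

theorem pairing_self_pos {u : SqSeq Idx} (hu : u ≠ 0) : 0 < pairing u u := by
  rw [pairing_apply]
  refine real_inner_self_pos.2 fun h => hu ?_
  ext k
  have h1 : diag (fun k => 1 / (1 + beta k ^ 2)) u k = 0 := by rw [h]; rfl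
  rw [diag_apply isBdd_flow] at h1
  exact (mul_eq_zero.1 h1).resolve_left (one_div_pos.2 (one_add_beta_sq_pos k)).ne'

/-- The coefficients of the nonlinear term `J(u, Δ v)`. -/
def nonlin : SqSeq Idx →L[ℝ] SqSeq Idx →L[ℝ] SqSeq Idx :=
  jac.bilinearComp (ContinuousLinearMap.id ℝ _) (diag lapWeight)

theorem nonlin_apply (u v : SqSeq Idx) : nonlin u v = jac u (diag lapWeight v) := rfl

theorem InClass.nonlin {G : AddSubgroup (ZMod 2 × ZMod 2)} {u v : SqSeq Idx} (hu : InClass G u)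
    (hv : InClass G v) : InClass G (nonlin u v) :=
  hu.jac (hv.diag isBdd_lapWeight)

theorem diag_lap_basic : diag lapWeight basic = (-2 : ℝ) • diag liftWeight basic := by
  rw [basic, map_smul, map_smul, diag_single isBdd_lapWeight, diag_single isBdd_liftWeight,
    lapWeight, liftWeight, beta_two_two]
  module

/-- Δψ₀ = -2ψ₀ and J(ψ₀, ψ₀) = 0. -/
theorem nonlin_basic_basic : nonlin basic basic = 0 := by
  have h : (2 : ℝ) • jac basic (diag liftWeight basic) = 0 := by
    rw [two_smul]
    nth_rewrite 1 [jac_antisymm basic basic]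
    exact neg_add_cancel _
  rw [nonlin_apply, diag_lap_basic, map_smul, (smul_eq_zero.1 h).resolve_left two_ne_zero,
    smul_zero]

/-- Linearizing J(ψ, Δψ) at ψ₀: since Δψ₀ = -2ψ₀, the term J(u, Δψ₀) equals 2J(ψ₀, u). -/
theorem nonlin_basic_add (u : SqSeq Idx) : nonlin basic u + nonlin u basic = advect u := by
  rw [nonlin_apply, nonlin_apply, diag_lap_basic, map_smul, jac_antisymm u basic, advect_apply,
    diag_two_add_lap, map_add, map_smul]
  module

theorem visc_smul (c s ν : ℝ) (u : SqSeq Idx) : visc (c * s) (c * ν) u = c • visc s ν u := by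
  rw [visc, visc, diag_smul (isBdd_viscWeight s ν) c fun k => ?_]
  rw [viscWeight, viscWeight]
  ring

theorem tendsto_inv_beta_sq : Tendsto (fun k : Idx => (1 / beta k) ^ 2) cofinite (𝓝 0) :=
  summable_inv_beta_sq.tendsto_cofinite_zero

/-- The gradient weights are only O(β^(-1/2)); their fourth powers are compared with the summable
β⁻². -/
theorem tendsto_zero_of_pow_four_le {d : Idx → ℝ} (h : ∀ k, (d k ^ 2) ^ 2 ≤ (1 / beta k) ^ 2) :
    Tendsto d cofinite (𝓝 0) := by
  have h1 : Tendsto (fun k => (d k ^ 2) ^ 2) cofinite (𝓝 0) :=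
    squeeze_zero (fun k => sq_nonneg _) h tendsto_inv_beta_sq
  have h2 := h1.sqrt
  simp only [Real.sqrt_sq (sq_nonneg _), Real.sqrt_zero] at h2
  have h3 := h2.sqrt
  simp only [Real.sqrt_sq_eq_abs, Real.sqrt_zero] at h3
  exact (tendsto_zero_iff_abs_tendsto_zero d).2 h3

theorem pow_four_le {a : ℝ} {k : Idx} (h : a ^ 2 ≤ beta k) :
    ((a / (1 + beta k)) ^ 2) ^ 2 ≤ (1 / beta k) ^ 2 := by
  have hb := beta_pos k
  have h1 := one_add_beta_pos k
  refine pow_le_pow_left₀ (sq_nonneg _) ?_ 2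
  rw [div_pow, div_le_div_iff₀ (by positivity) hb]
  nlinarith

/-- The gradient loses one derivative, while (2 + Δ)ψ has two to spare in L²: the weights of
`fieldX` and `fieldY` tend to zero, and multiplication by the bounded gradient of ψ₀ keeps
compactness. -/
theorem isCompactOperator_advect : IsCompactOperator advect := by
  have hX : IsCompactOperator fieldX :=
    (isCompactOperator_diag (tendsto_zero_of_pow_four_le fun k => pow_four_le (by
      rw [beta]; nlinarith [sq_nonneg (k.2 : ℝ)]))).clm_comp cosSinSeries
  have hY : IsCompactOperator fieldY :=
    (isCompactOperator_diag (tendsto_zero_of_pow_four_le fun k => pow_four_le (by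
      rw [beta]; nlinarith [sq_nonneg (k.1 : ℝ)]))).clm_comp sinCosSeries
  exact (((hY.clm_comp (mulL2 (flowX basic))).sub (hX.clm_comp (mulL2 (flowY basic)))).clm_comp
    coeffs).comp_clm (diag twoAddLapWeight)

/-- The inverse of the viscous operator. -/
def viscInv (s ν : ℝ) : SqSeq Idx →L[ℝ] SqSeq Idx := diag fun k => (viscWeight s ν k)⁻¹

theorem isBdd_inv_viscWeight {s ν : ℝ} (hν : 0 < ν) (hs : 0 ≤ s) :
    IsBdd fun k => (viscWeight s ν k)⁻¹ := by
  -- From β ≥ 1/2 comes 1 + β² ≤ 5β², and from s ≥ 0 comes β(s + νβ) ≥ νβ².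
  refine ⟨5 / ν, fun k => ?_⟩
  have hw := viscWeight_pos (s := s) hν (by positivity) k
  rw [abs_of_pos (inv_pos.2 hw), viscWeight, inv_div]
  have hb := half_le_beta k
  have hb' := beta_pos k
  rw [div_le_div_iff₀ (by positivity) hν]
  have h1 : 0 ≤ beta k * s := by positivity
  have h2 : 1 + beta k ^ 2 ≤ 5 * beta k ^ 2 := by nlinarith
  nlinarith

theorem visc_viscInv {s ν : ℝ} (hν : 0 < ν) (hs : 0 ≤ s) (u : SqSeq Idx) :
    visc s ν (viscInv s ν u) = u := by
  rw [visc, viscInv, diag_diag (isBdd_viscWeight s ν) (isBdd_inv_viscWeight hν hs) (f := fun _ => 1)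
    fun k => (mul_inv_cancel₀ (viscWeight_pos hν (by positivity) k).ne').symm, diag_one]

/-- A simple element of the kernel within a parity class. -/
structure IsSimpleKernel (s ν : ℝ) (G : AddSubgroup (ZMod 2 × ZMod 2)) (i : Idx)
    (c : SqSeq Idx) : Prop where
  nu_pos : 0 < ν
  s_nonneg : 0 ≤ s
  leading : ∀ k ∈ ({(1, 1), (1, 2), (2, 1)} : Set Idx), parity k ∈ G → k = i
  inClass : InClass G c
  ne_zero : c ≠ 0
  ker : linOp s ν c = 0

namespace IsSimpleKernel

variable {s ν : ℝ} {G : AddSubgroup (ZMod 2 × ZMod 2)} {i : Idx} {c : SqSeq Idx}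

theorem s_add_pos (h : IsSimpleKernel s ν G i c) : 0 < s + ν / 2 := by
  have := h.nu_pos
  have := h.s_nonneg
  positivity

/-- Of the three leading modes only `i` can belong to the class, so one coefficient controls all of
them. -/
theorem leading_eq_zero (h : IsSimpleKernel s ν G i c) {u : SqSeq Idx} (hu : InClass G u)
    (hi : u i = 0) : u (1, 1) = 0 ∧ u (1, 2) = 0 ∧ u (2, 1) = 0 := by
  have key : ∀ k ∈ ({(1, 1), (1, 2), (2, 1)} : Set Idx), u k = 0 := by
    intro k hk
    by_cases hp : parity k ∈ G
    · rw [h.leading k hk hp, hi]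
    · exact hu k hp
  exact ⟨key _ (by simp), key _ (by simp), key _ (by simp)⟩

theorem apply_ne_zero (h : IsSimpleKernel s ν G i c) : c i ≠ 0 := by
  intro hi
  obtain ⟨h1, h2, h3⟩ := h.leading_eq_zero h.inClass hi
  exact h.ne_zero (linOp_eq_zero h.nu_pos h.s_add_pos h.ker h1 h2 h3)

theorem sub_apply_eq_zero (h : IsSimpleKernel s ν G i c) (u : SqSeq Idx) :
    (u - (u i / c i) • c) i = 0 := by
  have := h.apply_ne_zero
  simp only [lp.coeFn_sub, lp.coeFn_smul, Pi.sub_apply, Pi.smul_apply, smul_eq_mul]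
  field_simp
  ring

theorem exists_eq_smul (h : IsSimpleKernel s ν G i c) {u : SqSeq Idx} (hu : InClass G u)
    (hk : linOp s ν u = 0) : ∃ a : ℝ, u = a • c := by
  obtain ⟨h1, h2, h3⟩ := h.leading_eq_zero (hu.sub (h.inClass.smul (u i / c i)))
    (h.sub_apply_eq_zero u)
  have := linOp_eq_zero h.nu_pos h.s_add_pos (by rw [map_sub, map_smul, hk, h.ker]; simp) h1 h2 h3
  exact ⟨_, sub_eq_zero.1 this⟩

/-- Transversality: the derivative in the parameter is not in the range of the linearization. -/
theorem linOp_ne_visc (h : IsSimpleKernel s ν G i c) {u : SqSeq Idx} (hu : InClass G u) :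
    linOp s ν u ≠ visc s ν c := by
  intro he
  have h1 := inner_linOp_self s ν c
  rw [h.ker, inner_zero_left] at h1
  have h2 := inner_linOp s ν u c
  rw [he, ← energy, ← h1] at h2
  have h3 := inner_linOp s ν c u
  rw [h.ker, inner_zero_left, inner_advect_antisymm, energy_comm] at h3
  have h4 := inner_linOp_self s ν u
  rw [he, ← energy, energy_comm] at h4
  -- Pairing Lu = Vc with c, and Lc = 0 with u, gives the cross energy plus and minus the same
  -- advection term. Both are zero, and pairing Lu = Vc with u then makes the energy of u vanish
  -- too.
  have h5 : energy s ν u c = 0 := by linarith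
  rw [h5] at h4
  -- The energy form vanishes on the span of u and c. This combination has zero i-th coefficient, so
  -- it reduces to the mode (2,2). Then Vw = Lw = Vc forces w = c, contradicting that the i-th
  -- coefficient of c is nonzero.
  set w := u - (u i / c i) • c with hw
  have hE : energy s ν w w = 0 := by
    have hexp : energy s ν w w = energy s ν u u - (u i / c i) * energy s ν u c
        - (u i / c i) * energy s ν c u + (u i / c i) ^ 2 * energy s ν c c := by
      simp only [hw, energy, map_sub, map_smul, inner_sub_left, inner_sub_right, inner_smul_left,
        inner_smul_right, conj_trivial]
      ring
    rw [hexp, energy_comm s ν c u, h5, ← h1, ← h4]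
    ring
  obtain ⟨a1, a2, a3⟩ := h.leading_eq_zero (hu.sub (h.inClass.smul (u i / c i)))
    (h.sub_apply_eq_zero u)
  have hA : advect w = 0 := advect_eq_zero fun k hk =>
    eq_zero_of_energy_eq_zero h.nu_pos h.s_add_pos hE a1 a2 a3 hk
  have hlin : linOp s ν w = visc s ν c := by
    rw [hw, map_sub, map_smul, h.ker, smul_zero, sub_zero, he]
  rw [linOp_apply, hA, add_zero] at hlin
  have hwc : w - c = 0 := visc_eq_zero h.nu_pos h.s_add_pos (by rw [map_sub, hlin, sub_self])
  have := h.sub_apply_eq_zero u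
  rw [← hw, sub_eq_zero.1 hwc] at this
  exact h.apply_ne_zero this

/-- The compact part of the bordered linearization, divided by the viscous operator. -/
def bordered (s ν : ℝ) (G : AddSubgroup (ZMod 2 × ZMod 2)) (c : SqSeq Idx) :
    SqSeq Idx →L[ℝ] SqSeq Idx :=
  (viscInv s ν).comp ((diag (classInd G)).comp advect + (pairing c).smulRight (visc s ν c))

theorem bordered_apply (s ν : ℝ) (G : AddSubgroup (ZMod 2 × ZMod 2)) (c u : SqSeq Idx) :
    bordered s ν G c u = viscInv s ν (diag (classInd G) (advect u) + pairing c u • visc s ν c) := rfl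

theorem isCompactOperator_bordered (s ν : ℝ) (G : AddSubgroup (ZMod 2 × ZMod 2)) (c : SqSeq Idx) :
    IsCompactOperator (bordered s ν G c) :=
  ((isCompactOperator_advect.clm_comp (diag (classInd G))).add
    ((isCompactOperator_of_locallyCompactSpace_rng
      (ContinuousLinearMap.toSpanSingleton ℝ (visc s ν c))).comp_clm (pairing c))).clm_comp (viscInv s ν)

/-- The cut-off in `bordered` lets the Fredholm alternative be used on the whole of ℓ²: solutions
for data in the class fall into the class by themselves. -/
theorem inClass_bordered (h : IsSimpleKernel s ν G i c) (u : SqSeq Idx) :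
    InClass G (bordered s ν G c u) :=
  ((inClass_diag_classInd G _).add ((h.inClass.visc s ν).smul _)).diag
    (isBdd_inv_viscWeight h.nu_pos h.s_nonneg)

/-- The bordered equation, for right-hand sides in the parity class. -/
theorem linOp_of_bordered (h : IsSimpleKernel s ν G i c) {u g : SqSeq Idx} (hg : InClass G g)
    (he : u + bordered s ν G c u = viscInv s ν g) :
    InClass G u ∧ linOp s ν u + pairing c u • visc s ν c = g := by
  have hu : InClass G u := by
    rw [← eq_sub_iff_add_eq] at he
    rw [he]
    exact (hg.diag (isBdd_inv_viscWeight h.nu_pos h.s_nonneg)).sub (h.inClass_bordered u)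
  refine ⟨hu, ?_⟩
  have h1 := congrArg (visc s ν) he
  rw [map_add, bordered_apply, visc_viscInv h.nu_pos h.s_nonneg, visc_viscInv h.nu_pos h.s_nonneg,
    diag_classInd_of_inClass hu.advect, ← add_assoc] at h1
  exact h1

/-- Transversality forces (c, u) = 0; then u lies in the kernel, hence is a multiple of c, and
orthogonality to c makes it zero. -/
theorem bordered_injective (h : IsSimpleKernel s ν G i c) (u : SqSeq Idx)
    (hu : u + bordered s ν G c u = 0) : u = 0 := by
  have h0 : InClass G 0 := fun _ _ => rfl
  obtain ⟨hc, he⟩ := h.linOp_of_bordered (u := u) h0 (by rw [hu, map_zero])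
  have hp : pairing c u = 0 := by
    by_contra hne
    refine h.linOp_ne_visc (hc.smul (-(pairing c u)⁻¹)) ?_
    rw [map_smul, eq_neg_of_add_eq_zero_left he, smul_neg, neg_smul, neg_neg, inv_smul_smul₀ hne]
  rw [hp, zero_smul, add_zero] at he
  obtain ⟨a, rfl⟩ := h.exists_eq_smul hc he
  rw [map_smul, smul_eq_mul] at hp
  rw [(mul_eq_zero.1 hp).resolve_right (pairing_self_pos h.ne_zero).ne', zero_smul]

/-- The projection along the kernel element. -/
def complement (c : SqSeq Idx) : SqSeq Idx →L[ℝ] SqSeq Idx :=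
  ContinuousLinearMap.id ℝ _ - (pairing c).smulRight ((pairing c c)⁻¹ • c)

theorem complement_apply (c u : SqSeq Idx) :
    complement c u = u - pairing c u • (pairing c c)⁻¹ • c := rfl

theorem pairing_complement (h : IsSimpleKernel s ν G i c) (u : SqSeq Idx) :
    pairing c (complement c u) = 0 := by
  have := (pairing_self_pos h.ne_zero).ne'
  rw [complement_apply, map_sub, map_smul, map_smul, smul_eq_mul, smul_eq_mul,
    inv_mul_cancel₀ this, mul_one, sub_self]

theorem linOp_complement (h : IsSimpleKernel s ν G i c) (u : SqSeq Idx) :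
    linOp s ν (complement c u) = linOp s ν u := by
  rw [complement_apply, map_sub, map_smul, map_smul, h.ker, smul_zero, smul_zero, sub_zero]

theorem inClass_complement (h : IsSimpleKernel s ν G i c) {u : SqSeq Idx} (hu : InClass G u) :
    InClass G (complement c u) :=
  hu.sub ((h.inClass.smul _).smul _)

/-- Solvability of the rescaled bifurcation equation. -/
theorem exists_branch (h : IsSimpleKernel s ν G i c) :
    ∃ ε₀ > (0 : ℝ), ∃ C : ℝ, ∀ ε, 0 < ε → ε < ε₀ → ∃ (δ : ℝ) (f : SqSeq Idx),
      pairing c f = 0 ∧ |δ| ≤ C ∧ ‖f‖ ≤ C ∧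
      linOp s ν f + δ • visc s ν c + nonlin c c
        + ε • (nonlin c f + nonlin f c + δ • visc s ν f + ε • nonlin f f) = 0 := by
  obtain ⟨R, hR⟩ := exists_rightInverse_of_compact (isCompactOperator_bordered s ν G c)
    h.bordered_injective
  -- `M g` is the solution b of the bordered problem Lb + (c, b)Vc = -g, with g first projected to
  -- the class.
  set M : SqSeq Idx →L[ℝ] SqSeq Idx := (-R).comp ((viscInv s ν).comp (diag (classInd G))) with hM
  set Φ := complement c with hΦ
  -- With δ = (c, b) and φ = Φb, the arguments come from J(c, Δc), from the cross terms of c and φ,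
  -- from δVφ, and from J(φ, Δφ), which carries one more power of ε.
  obtain ⟨ε₀, hε₀, C, hC⟩ := exists_fixedPoint_quadratic (M (nonlin c c))
    (M.comp ((nonlin c).comp Φ + (nonlin.flip c).comp Φ))
    ((pairing c).smulRight (M.comp ((visc s ν).comp Φ)))
    ((ContinuousLinearMap.compL ℝ _ _ _ M).comp (nonlin.bilinearComp Φ Φ))
  refine ⟨ε₀, hε₀, (‖pairing c‖ + ‖Φ‖) * |C|, fun ε h1 h2 => ?_⟩
  obtain ⟨b, hbC, hb⟩ := hC ε h1 h2
  have hbC' : ‖b‖ ≤ |C| := hbC.trans (le_abs_self C)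
  refine ⟨pairing c b, Φ b, h.pairing_complement b, ?_, ?_, ?_⟩
  · calc |pairing c b| ≤ ‖pairing c‖ * ‖b‖ := (pairing c).le_opNorm b
      _ ≤ (‖pairing c‖ + ‖Φ‖) * |C| := by
        gcongr
        exact le_add_of_nonneg_right (norm_nonneg _)
  · calc ‖Φ b‖ ≤ ‖Φ‖ * ‖b‖ := Φ.le_opNorm b
      _ ≤ (‖pairing c‖ + ‖Φ‖) * |C| := by
        gcongr
        exact le_add_of_nonneg_left (norm_nonneg _)
  set g := nonlin c c + ε • (nonlin c (Φ b) + nonlin (Φ b) c + pairing c b • visc s ν (Φ b)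
    + ε • nonlin (Φ b) (Φ b)) with hg
  have hbM : M g = b := by
    refine Eq.trans ?_ hb
    rw [hg, map_add, map_smul, map_add, map_add, map_smul, map_smul]
    rfl
  have hbR : b = R (viscInv s ν (diag (classInd G) (-g))) := by
    rw [← hbM, hM]
    simp
  have hsol : b + bordered s ν G c b = viscInv s ν (diag (classInd G) (-g)) := by
    conv_lhs => rw [hbR]
    exact hR _
  -- The solution lies in the class, hence so does `g`, and the projection inside `M` changed
  -- nothing.
  obtain ⟨hbG, heq⟩ := h.linOp_of_bordered (inClass_diag_classInd G _) hsol
  have hΦG : InClass G (Φ b) := h.inClass_complement hbG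
  have hgG : InClass G g := by
    refine (h.inClass.nonlin h.inClass).add (InClass.smul ?_ ε)
    exact (((h.inClass.nonlin hΦG).add (hΦG.nonlin h.inClass)).add ((hΦG.visc s ν).smul _)).add
      ((hΦG.nonlin hΦG).smul ε)
  rw [diag_classInd_of_inClass hgG.neg] at heq
  rw [hΦ, h.linOp_complement, ← hΦ, add_assoc, ← hg, heq, neg_add_cancel]

/-- Orders of ε: order 0 is the steadiness of ψ₀, order 1 is Lc = 0, and the rest is ε² times the
rescaled equation, since ν and μ are multiplied by the same 1 + εδ. -/
theorem steady_equation (h : IsSimpleKernel s ν G i c) {ε δ : ℝ} {f : SqSeq Idx}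
    (hf : linOp s ν f + δ • visc s ν c + nonlin c c
        + ε • (nonlin c f + nonlin f c + δ • visc s ν f + ε • nonlin f f) = 0) :
    nonlin (basic + ε • c + ε ^ 2 • f) (basic + ε • c + ε ^ 2 • f)
      + visc (s + ε * δ * s) (ν + ε * δ * ν) (ε • c + ε ^ 2 • f) = 0 := by
  have h1 : ∀ x : ℝ, x + ε * δ * x = (1 + ε * δ) * x := fun x => by ring
  have h2 := h.ker
  rw [linOp_apply, ← nonlin_basic_add] at hf h2
  rw [h1, h1, visc_smul]
  simp only [map_add, map_smul, add_apply, smul_apply, nonlin_basic_basic]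
  linear_combination (norm := module) (ε ^ 2) • hf + ε • h2

end IsSimpleKernel

/-! ### The steady problem -/

theorem isSteadySolution_of_coeffs {s ν : ℝ} {v : SqSeq Idx}
    (h : nonlin (basic + v) (basic + v) + visc s ν v = 0) :
    IsSteadySolution ν s (flow (basic + v)) := by
  obtain ⟨j, hj, hj'⟩ := hasJacobian_flow (basic + v) (diag lapWeight (basic + v)) (coeFn_field_lap _)
  have hv : (fun p => flow (basic + v) p - psi0 p) = flow v := by
    rw [← flow_basic, map_add]
    ext p
    simp
  refine ⟨flow_mem_H4 _, flowLap (basic + v), j, flowLap v, flowBilap v, hasWeakLaplacian_flow _,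
    (flowLap _).continuous.continuousOn, fun p hp => ⟨?_, ?_⟩, hj, ?_, hasWeakLaplacian_flowLap v, ?_⟩
  · exact synth_eq_zero_of_frontier summable_flow _ hp
  · exact synth_eq_zero_of_frontier summable_flowLap _ hp
  · rw [hv]
    exact hasWeakLaplacian_flow v
  · filter_upwards [hj', (coeffs_add_visc_eq_zero_iff s ν _ v).1 h] with p h1 h2
    rw [h1]
    exact h2

theorem exists_steady_branch {νc μc : ℝ} {G : AddSubgroup (ZMod 2 × ZMod 2)} {i : Idx}
    {c : SqSeq Idx} (h : IsSimpleKernel μc νc G i c) :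
    ∃ ε₀ > (0 : ℝ), ∃ C : ℝ, ∃ (δ : ℝ → ℝ) (φ : ℝ → (ℝ × ℝ → ℝ)),
      ∀ ε, 0 < ε → ε < ε₀ →
        φ ε ∈ H4 ∧ l2Inner (flow c) (φ ε) = 0 ∧ |δ ε| ≤ C ∧ h4Norm (φ ε) ≤ C ∧
        IsSteadySolution (νc + ε * δ ε * νc) (μc + ε * δ ε * μc)
          (fun p => psi0 p + ε * flow c p + ε ^ 2 * φ ε p) := by
  obtain ⟨ε₀, hε₀, C, hC⟩ := h.exists_branch
  choose! δ f hf using hC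
  refine ⟨ε₀, hε₀, C, δ, fun ε => flow (f ε), fun ε h1 h2 => ?_⟩
  obtain ⟨a1, a2, a3, a4⟩ := hf ε h1 h2
  refine ⟨flow_mem_H4 _, (l2Inner_flow _ _).trans a1, a2, (h4Norm_flow _).trans_le a3, ?_⟩
  have := h.steady_equation a4
  rw [add_assoc] at this
  convert isSteadySolution_of_coeffs this using 1
  ext p
  rw [map_add, map_add, map_smul, map_smul, ← flow_basic]
  simp [add_assoc]

theorem exists_isSimpleKernel {νc μc : ℝ} {ψ : ℝ × ℝ → ℝ} (hν : 0 < νc) (hμ : 0 ≤ μc)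
    (hψ : IsEigenfunction 0 νc μc ψ) (hE : ψ ∈ E₁ ∪ E₂ ∪ E₃) :
    ∃ G i c, IsSimpleKernel μc νc G i c ∧ ψ = flow c := by
  obtain ⟨c, rfl, hc⟩ := exists_flow_eq hψ.1
  obtain ⟨hne, hker⟩ := (isEigenfunction_flow_iff _ _ _ _).1 hψ
  rw [zero_add] at hker
  have hev : ∀ n : ℕ+, ((n : ℕ) : ZMod 2) ≠ 0 → ¬ Even (n : ℕ) :=
    fun n hn he => hn (ZMod.natCast_eq_zero_iff_even.2 he)
  rcases hE with (hE | hE) | hE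
  -- Parities with zero sum: odd-odd together with even-even, containing only the leading mode
  -- (1,1).
  · refine ⟨(AddMonoidHom.coprod (AddMonoidHom.id (ZMod 2)) (AddMonoidHom.id (ZMod 2))).ker, (1, 1), c,
      ⟨hν, hμ, ?_, ?_, hne, hker⟩, rfl⟩
    · rintro k (rfl | rfl | rfl) hk
      · rfl
      · exact absurd (AddMonoidHom.mem_ker.1 hk) (by decide)
      · exact absurd (AddMonoidHom.mem_ker.1 hk) (by decide)
    · rintro ⟨n, m⟩ hk
      rw [hc, hE.2 n m, mul_zero]
      rintro ⟨hn, hm⟩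
      refine hk (AddMonoidHom.mem_ker.2 ?_)
      rw [(parity_eq_iff n m 1 1).2 ⟨ZMod.natCast_eq_one_iff_odd.2 hn, ZMod.natCast_eq_one_iff_odd.2 hm⟩]
      decide
  -- Second index even, first index free; the leading mode is (1,2).
  · refine ⟨(AddMonoidHom.snd (ZMod 2) (ZMod 2)).ker, (1, 2), c, ⟨hν, hμ, ?_, ?_, hne, hker⟩, rfl⟩
    · rintro k (rfl | rfl | rfl) hk
      · exact absurd (AddMonoidHom.mem_ker.1 hk) (by decide)
      · rfl
      · exact absurd (AddMonoidHom.mem_ker.1 hk) (by decide)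
    · rintro ⟨n, m⟩ hk
      rw [hc, hE.2 n m, mul_zero]
      exact fun hh => hev m (fun h0 => hk (AddMonoidHom.mem_ker.2 h0)) hh.2
  -- First index even, second index free; the leading mode is (2,1).
  · refine ⟨(AddMonoidHom.fst (ZMod 2) (ZMod 2)).ker, (2, 1), c, ⟨hν, hμ, ?_, ?_, hne, hker⟩, rfl⟩
    · rintro k (rfl | rfl | rfl) hk
      · exact absurd (AddMonoidHom.mem_ker.1 hk) (by decide)
      · exact absurd (AddMonoidHom.mem_ker.1 hk) (by decide)
      · rfl
    · rintro ⟨n, m⟩ hk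
      rw [hc, hE.2 n m, mul_zero]
      exact fun hh => hev n (fun h0 => hk (AddMonoidHom.mem_ker.2 h0)) hh.1

end VortexFlow

end

theorem theorem1 :
    -- (i) the spectral problem
    (∀ lam ν μ : ℝ, 0 < ν → 0 ≤ μ → 0 < lam + μ + ν / 2 →
      -- at most three linearly independent eigenfunctions
      (∀ (k : ℕ) (v : Fin k → (ℝ × ℝ → ℝ)),
        (∀ j, VortexFlow.IsEigenfunction lam ν μ (v j)) → LinearIndependent ℝ v → k ≤ 3) ∧
      -- the eigenspace is spanned by eigenfunctions lying in the parity subspaces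
      (∀ ψ, VortexFlow.IsEigenfunction lam ν μ ψ →
        ψ ∈ Submodule.span ℝ
          {φ | VortexFlow.IsEigenfunction lam ν μ φ ∧
            φ ∈ VortexFlow.E₁ ∪ VortexFlow.E₂ ∪ VortexFlow.E₃})) ∧
    -- (ii) bifurcation at a critical spectral solution
    (∀ (νc μc : ℝ) (ψc : ℝ × ℝ → ℝ), 0 < νc → 0 ≤ μc →
      VortexFlow.IsEigenfunction 0 νc μc ψc →
      ψc ∈ VortexFlow.E₁ ∪ VortexFlow.E₂ ∪ VortexFlow.E₃ →
      ∃ ε₀ > (0 : ℝ), ∃ C : ℝ, ∃ (δ : ℝ → ℝ) (φ : ℝ → (ℝ × ℝ → ℝ)),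
        ∀ ε, 0 < ε → ε < ε₀ →
          φ ε ∈ VortexFlow.H4 ∧ VortexFlow.l2Inner ψc (φ ε) = 0 ∧
          |δ ε| ≤ C ∧ VortexFlow.h4Norm (φ ε) ≤ C ∧
          VortexFlow.IsSteadySolution (νc + ε * δ ε * νc) (μc + ε * δ ε * μc)
            (fun p => VortexFlow.psi0 p + ε * ψc p + ε ^ 2 * φ ε p)) := by
  refine ⟨fun lam ν μ hν hμ h => ⟨fun k v hv hli => VortexFlow.card_le_three hν h hv hli,
    fun ψ hψ => VortexFlow.eigenfunction_mem_span hν h hψ⟩, fun νc μc ψc hν hμ hψ hE => ?_⟩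
  obtain ⟨G, i, c, hc, rfl⟩ := VortexFlow.exists_isSimpleKernel hν hμ hψ hE
  exact VortexFlow.exists_steady_branch hc
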